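/- Let $n,d,p$ be natural numbers with $n\ge 1$, and let $\mathcal X\subset\mathbb R^d$ and $\mathcal Y\subset\mathbb R^p$ be bounded Borel sets, $\mathcal Y\neq\emptyset$. Let $(\mathcal W,d_{\mathcal W})$ be a nonempty compact metric space and $\{P^w_{XY}: w\in\mathcal W\}$ a family of probability measures on $\mathcal Z=\mathcal X\times\mathcal Y$ such that each $P^w_{XY}$ has a density $f(x,y|w)$ with respect to Lebesgue measure which, for every $(x,y)\in\mathcal X\times\mathcal Y$, is bounded and continuous in $w$. Let $\ell:\mathcal Y\times\mathcal Y\to\mathbb R$ be a measurable bounded loss function. A learning algorithm is a measurable map $A:\mathcal Z^n\times\mathcal X\to\mathcal Y$, and $\mathcal A$ is the space of all of them. Its excess risk at $w\in\mathcal W$ is $$e(A,w)=\mathbb E^w[\ell(A(Z^n,X),Y)]-L^*(w),\qquad L^*(w)=\inf_{f:\mathcal X\to\mathcal Y\ \text{measurable}}\mathbb E^w[\ell(f(X),Y)],$$ where under $w$ the training sample $Z^n=(Z_1,\dots,Z_n)$ and the test pair $Z=(X,Y)$ are $n+1$ i.i.d. draws from $P^w_{XY}$. Let $d_{\mathcal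 A}$ be a metric (a pseudometric suffices) on $\mathcal A$ for which $A\mapsto e(A,w)$ is Borel measurable for every $w$. Let $\Delta(\mathcal W)$ and $\Delta(\mathcal A)$ be the sets of all Borel probability measures on $\mathcal W$ and $\mathcal A$; under $P_W\in\Delta(\mathcal W)$ and $P_{\mathcal A}\in\Delta(\mathcal A)$, $W\sim P_W$ and $A\sim P_{\mathcal A}$ are independent. For $P_W\in\Delta(\mathcal W)$, let $W\sim P_W$ and, given $W=w$, let $Z^n,(X,Y)$ be as above. Put $I(W;Z^n)=\mathrm{KL}(P_{WZ^n}\,\|\,P_W\otimes P_{Z^n})$ and $$I(W;Y|X,Z^n)=\mathbb E_{X,Z^n}\big[\mathrm{KL}(P_{WY}^{X,Z^n}\,\|\,P_W^{X,Z^n}\otimes P_Y^{X,Z^n})\big],$$ where superscripts denote regular conditional distributions and logarithms are natural. Let $\kappa_n\in[0,\infty]$ be such that $\sup_{P_W\in\Delta(\mathcal W)}I(W;Z^n)\le\kappa_n$, and let $B\ge 0$. Then: (a) If $\mathcal Y$ is convex, $\ell(y,y')=\|y-y'\|^2$, and $\|y\|^2\le B$ for all $y\in\mathcal Y$, then $$\inf_{P_{\mathcal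 A}\in\Delta(\mathcal A)}\ \sup_{P_W\in\Delta(\mathcal W)}\mathbb E_{A,W}[e(A,W)]\ \le\ 2B\sup_{P_W\in\Delta(\mathcal W)}I(W;Y|X,Z^n)\ \le\ \frac{2B\kappa_n}{n}.$$ (b) If $0\le\ell\le B$ and $L^*(w)=0$ for all $w\in\mathcal W$, then $$\inf_{P_{\mathcal A}\in\Delta(\mathcal A)}\ \sup_{P_W\in\Delta(\mathcal W)}\mathbb E_{A,W}[e(A,W)]\ \le\ 3B\sup_{P_W\in\Delta(\mathcal W)}I(W;Y|X,Z^n)\ \le\ \frac{3B\kappa_n}{n}.$$ (c) If $0\le\ell\le B$, then $$\inf_{P_{\mathcal A}\in\Delta(\mathcal A)}\ \sup_{P_W\in\Delta(\mathcal W)}\mathbb E_{A,W}[e(A,W)]\ \le\ B\sqrt{\tfrac12\sup_{P_W\in\Delta(\mathcal W)}I(W;Y|X,Z^n)}\ \le\ B\sqrt{\frac{\kappa_n}{2n}}.$$ Here $0\cdot\infty=0$. -/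

import Mathlib

open MeasureTheory ProbabilityTheory InformationTheory
open scoped ENNReal NNReal

noncomputable section

namespace MinimaxExcessRisk

/-! ### Information measures -/

/-- Mutual information `I(U;V) = KL(P_{UV} ‖ P_U ⊗ P_V)`, in nats. -/
def mutualInfo {Ω α β : Type*} [MeasurableSpace Ω] [MeasurableSpace α] [MeasurableSpace β]
    (U : Ω → α) (V : Ω → β) (μ : Measure Ω) : ℝ≥0∞ :=
  klDiv (μ.map (fun ω => (U ω, V ω))) ((μ.map U).prod (μ.map V))

/-- Conditional mutual information
`I(U;V|T) = 𝔼_T [KL(P_{UV}^T ‖ P_U^T ⊗ P_V^T)]`, in nats, where superscripts denote regular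
conditional distributions. -/
def condMutualInfo {Ω α β γ : Type*} [MeasurableSpace Ω]
    [MeasurableSpace α] [StandardBorelSpace α] [Nonempty α]
    [MeasurableSpace β] [StandardBorelSpace β] [Nonempty β] [MeasurableSpace γ]
    (U : Ω → α) (V : Ω → β) (T : Ω → γ) (μ : Measure Ω) [IsFiniteMeasure μ] : ℝ≥0∞ :=
  ∫⁻ t, klDiv (condDistrib (fun ω => (U ω, V ω)) T μ t)
    ((condDistrib U T μ t).prod (condDistrib V T μ t)) ∂(μ.map T)

/-! ### Data: a parametric family of distributions, samples, joint laws -/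

/-- The law of `n` i.i.d. draws from `P w`, as a Markov kernel in the parameter `w`. -/
def iidKernel {W Z : Type*} [MeasurableSpace W] [MeasurableSpace Z]
    (P : Kernel W Z) [IsMarkovKernel P] (n : ℕ) : Kernel W (Fin n → Z) where
  toFun w := Measure.pi (fun _ => P w)
  measurable' := by
    refine Measurable.measure_of_isPiSystem_of_isProbabilityMeasure
      generateFrom_pi.symm isPiSystem_pi ?_
    rintro s ⟨t, ht, rfl⟩
    simp only [Measure.pi_pi]
    exact Finset.measurable_prod _ fun i _ => P.measurable_coe (ht i (Set.mem_univ i))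

instance {W Z : Type*} [MeasurableSpace W] [MeasurableSpace Z]
    (P : Kernel W Z) [IsMarkovKernel P] (n : ℕ) : IsMarkovKernel (iidKernel P n) :=
  ⟨fun w => inferInstanceAs (IsProbabilityMeasure (Measure.pi (fun _ : Fin n => P w)))⟩

/-- The joint law of `(W, (Zⁿ, (X, Y)))`: the parameter `W` has prior `π` and, given `W = w`, the
training sample `Zⁿ` and the test pair `(X, Y)` are `n + 1` i.i.d. draws from `P w`. -/
def jointLaw {W Z : Type*} [MeasurableSpace W] [MeasurableSpace Z]
    (P : Kernel W Z) [IsMarkovKernel P] (n : ℕ) (π : ProbabilityMeasure W) :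
    Measure (W × ((Fin n → Z) × Z)) :=
  (π : Measure W) ⊗ₘ (iidKernel P n ×ₖ P)

instance {W Z : Type*} [MeasurableSpace W] [MeasurableSpace Z]
    (P : Kernel W Z) [IsMarkovKernel P] (n : ℕ) (π : ProbabilityMeasure W) :
    IsProbabilityMeasure (jointLaw P n π) :=
  inferInstanceAs (IsProbabilityMeasure ((π : Measure W) ⊗ₘ (iidKernel P n ×ₖ P)))

/-- `I(W;Zⁿ)` under the prior `π`. -/
def sampleInfo {W Z : Type*} [MeasurableSpace W] [MeasurableSpace Z]
    (P : Kernel W Z) [IsMarkovKernel P] (n : ℕ) (π : ProbabilityMeasure W) : ℝ≥0∞ :=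
  mutualInfo (fun ω => ω.1) (fun ω => ω.2.1) (jointLaw P n π)

/-- The capacity `sup_{P_W} I(W;Zⁿ)` of the channel from `W` to `Zⁿ`. -/
def capacity {W Z : Type*} [MeasurableSpace W] [MeasurableSpace Z]
    (P : Kernel W Z) [IsMarkovKernel P] (n : ℕ) : ℝ≥0∞ :=
  ⨆ π : ProbabilityMeasure W, sampleInfo P n π

/-- `I(W;Y|X,Zⁿ)` under the prior `π`. -/
def predictiveInfo {W X Y : Type*}
    [MeasurableSpace W] [StandardBorelSpace W] [Nonempty W] [MeasurableSpace X]
    [MeasurableSpace Y] [StandardBorelSpace Y] [Nonempty Y]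
    (P : Kernel W (X × Y)) [IsMarkovKernel P] (n : ℕ) (π : ProbabilityMeasure W) : ℝ≥0∞ :=
  condMutualInfo (fun ω => ω.1) (fun ω => ω.2.2.2) (fun ω => (ω.2.2.1, ω.2.1)) (jointLaw P n π)

/-- `sup_{P_W} I(W;Y|X,Zⁿ)`. -/
def worstPredictiveInfo {W X Y : Type*}
    [MeasurableSpace W] [StandardBorelSpace W] [Nonempty W] [MeasurableSpace X]
    [MeasurableSpace Y] [StandardBorelSpace Y] [Nonempty Y]
    (P : Kernel W (X × Y)) [IsMarkovKernel P] (n : ℕ) : ℝ≥0∞ :=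
  ⨆ π : ProbabilityMeasure W, predictiveInfo P n π

/-! ### Learning algorithms and excess risk -/

/-- A (deterministic) learning algorithm `A : (X × Y)ⁿ × X → Y`; all measurable maps are
allowed. -/
structure LearningAlgorithm (n : ℕ) (X Y : Type*) [MeasurableSpace X] [MeasurableSpace Y] where
  /-- the prediction made from the training sample and the test input -/
  predict : (Fin n → X × Y) × X → Y
  /-- the prediction depends measurably on its arguments -/
  measurable_predict : Measurable predict

/-- The expected loss `𝔼[ℓ(A(Zⁿ, X), Y)]` when `Zⁿ` and `(X, Y)` are i.i.d. with law `P w`. -/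
def expectedLoss {W X Y : Type*} [MeasurableSpace W] [MeasurableSpace X] [MeasurableSpace Y]
    {n : ℕ} (P : Kernel W (X × Y)) (ℓ : Y → Y → ℝ) (A : LearningAlgorithm n X Y) (w : W) : ℝ :=
  ∫ ζ : (Fin n → X × Y) × (X × Y), ℓ (A.predict (ζ.1, ζ.2.1)) ζ.2.2
    ∂((Measure.pi (fun _ => P w)).prod (P w))

/-- The least expected loss `inf_f 𝔼[ℓ(f(X), Y)]` over all measurable `f : X → Y` when `(X, Y)`
has law `P w`; it is `𝔼[ℓ(f*_w(X), Y)]` for any minimizer `f*_w`. -/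
def optimalLoss {W X Y : Type*} [MeasurableSpace W] [MeasurableSpace X] [MeasurableSpace Y]
    (P : Kernel W (X × Y)) (ℓ : Y → Y → ℝ) (w : W) : ℝ :=
  ⨅ f : {f : X → Y // Measurable f}, ∫ z, ℓ (f.1 z.1) z.2 ∂(P w)

/-- The excess risk `e(A, w)`. -/
def excessRisk {W X Y : Type*} [MeasurableSpace W] [MeasurableSpace X] [MeasurableSpace Y]
    {n : ℕ} (P : Kernel W (X × Y)) (ℓ : Y → Y → ℝ) (A : LearningAlgorithm n X Y) (w : W) : ℝ :=
  expectedLoss P ℓ A w - optimalLoss P ℓ w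

/-- The minimax excess risk `inf_{P_A} sup_{P_W} 𝔼_{A,W}[e(A, W)]` over independent `A ∼ P_A` and
`W ∼ P_W`, computed in the extended reals. -/
def minimaxExcessRisk {W X Y : Type*} [MeasurableSpace W] [MeasurableSpace X] [MeasurableSpace Y]
    (n : ℕ) [MeasurableSpace (LearningAlgorithm n X Y)]
    (P : Kernel W (X × Y)) (ℓ : Y → Y → ℝ) : EReal :=
  ⨅ Q : ProbabilityMeasure (LearningAlgorithm n X Y), ⨆ π : ProbabilityMeasure W,
    ((∫ A, ∫ w, excessRisk P ℓ A w ∂(π : Measure W)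
      ∂(Q : Measure (LearningAlgorithm n X Y)) : ℝ) : EReal)

end MinimaxExcessRisk

end

/-! A randomised algorithm facing the worst prior does as well, up to an arbitrarily small error, as
algorithms tailored to each prior, so it suffices to bound Bayes excess risks, and only for finitely
supported priors. On finitely many states this is a Hahn-Banach separation (`exists_mixture_lt`).
The passage to compact `W` is `exists_probabilityMeasure_integral_le`: pointwise continuity of the
densities gives continuity of `w ↦ P w` in total variation (`eventually_tvBound`), hence
equicontinuity of the excess risks uniformly in the algorithm, and a finite net of states is enough.

Fix a finitely supported prior and put `T = (X, Zⁿ)`. The oracle uses a near-optimal rule for the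
true `W`. A competitor that uses the rule of a copy of `W`, drawn from the posterior given `T` and
independent of `Y` given `T`, differs from it only in that the conditional law of `(W, Y)` is
replaced by the product of its marginals; the averaged divergence between the two is `I(W;Y|T)`. The
rule of least posterior risk is deterministic and no worse than the competitor. The change of
measure is done by bounding `klFun` from below by affine functions of the density
(`ofReal_integral_add_le_condMutualInfo`): one affine bound gives the linear rate in the realizable
case, another the square root for general bounded losses. For squared loss the posterior mean is
compared with the oracle directly, and the squared distance between the two predictions absorbs the
first-order error, which removes the square root.

The rate `1 / n` comes from the chain rule: `I(W;Zⁿ)` dominates a sum of `n` terms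
`I(W;Z_{k+1}|Zᵏ)`, these decrease in `k` for i.i.d. draws, and `I(W;Y|X,Zⁿ)` is at most the term
with `k = n`. -/

noncomputable section

namespace MinimaxExcessRisk

/-! ### Variational bounds for conditional mutual information. -/

section Information

/-- Averaged Kullback-Leibler divergence is at most the divergence of the composition-products. -/
theorem lintegral_klDiv_le {α β : Type*} [MeasurableSpace α] [MeasurableSpace β]
    [MeasurableSpace.CountableOrCountablyGenerated α β] (μ : Measure α) [IsFiniteMeasure μ]
    (κ η : Kernel α β) [IsMarkovKernel κ] [IsMarkovKernel η] :
    ∫⁻ a, klDiv (κ a) (η a) ∂μ ≤ klDiv (μ ⊗ₘ κ) (μ ⊗ₘ η) := by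
  by_cases hac : μ ⊗ₘ κ ≪ μ ⊗ₘ η
  swap
  · simp [klDiv_of_not_ac hac]
  set r : α → β → ℝ≥0∞ := fun a b => κ.rnDeriv η a b with hr
  have hrm : Measurable (Function.uncurry r) := Kernel.measurable_rnDeriv κ η
  have hae : ∀ᵐ a ∂μ, κ a ≪ η a := hac.kernel_of_compProd
  have hκ : ∀ᵐ a ∂μ, κ a = η.withDensity r a := by
    filter_upwards [hae] with a ha
    have h := Kernel.rnDeriv_add_singularPart κ η
    have h2 := (Kernel.singularPart_eq_zero_iff_absolutelyContinuous κ η a).2 ha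
    conv_lhs => rw [← h]
    simp [h2, hr]
  have hfin : IsFiniteKernel (η.withDensity r) := by infer_instance
  -- The density of the joint laws is the fibrewise density, so Tonelli turns the joint divergence
  -- into the average of the fibre divergences.
  have hcomp : μ ⊗ₘ κ = (μ ⊗ₘ η).withDensity (fun p => r p.1 p.2) := by
    rw [Measure.compProd_congr hκ, Measure.compProd_withDensity hrm]
  have hrn : (μ ⊗ₘ κ).rnDeriv (μ ⊗ₘ η) =ᵐ[μ ⊗ₘ η] fun p => r p.1 p.2 := by
    rw [hcomp]
    exact Measure.rnDeriv_withDensity _ hrm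
  rw [klDiv_eq_lintegral_klFun_of_ac hac,
    lintegral_congr_ae (hrn.mono fun p hp => by rw [hp]), Measure.lintegral_compProd]
  · refine lintegral_mono_ae ?_
    filter_upwards [hae] with a ha
    rw [klDiv_eq_lintegral_klFun_of_ac ha]
    refine (lintegral_congr_ae ?_).le
    filter_upwards [Kernel.rnDeriv_eq_rnDeriv_measure (κ := κ) (η := η) (a := a)] with b hb
    rw [← hb]
  · exact (measurable_klFun.comp hrm.ennreal_toReal).ennreal_ofReal

/-- Among all predictive kernels `c` for `V` given `T`, the conditional distribution of `V` given
`T` minimizes the divergence from the joint law of `((U, T), V)`. -/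
theorem klDiv_condKernel_le {α β γ : Type*} [MeasurableSpace α] [StandardBorelSpace α] [Nonempty α]
    [MeasurableSpace β] [MeasurableSpace γ]
    (ρ : Measure ((α × β) × γ)) [IsProbabilityMeasure ρ]
    (c₀ c : Kernel β γ) [IsMarkovKernel c₀] [IsMarkovKernel c]
    (hc₀ : ρ.map (fun p => (p.1.2, p.2)) = ρ.fst.snd ⊗ₘ c₀) :
    klDiv ρ (ρ.fst ⊗ₘ c₀.comap Prod.snd measurable_snd) ≤
      klDiv ρ (ρ.fst ⊗ₘ c.comap Prod.snd measurable_snd) := by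
  let e : (α × β) × γ → (β × γ) × α := fun p => ((p.1.2, p.2), p.1.1)
  let e' : (β × γ) × α → (α × β) × γ := fun p => ((p.2, p.1.1), p.1.2)
  have he : Measurable e := by fun_prop
  have he' : Measurable e' := by fun_prop
  have hee' : e' ∘ e = id := rfl
  let H : Kernel β α := condDistrib (fun p : α × β => p.1) (fun p => p.2) ρ.fst
  let H' : Kernel (β × γ) α := H.comap Prod.fst measurable_fst
  let K : Kernel (β × γ) α := condDistrib (fun p : (α × β) × γ => p.1.1) (fun p => (p.1.2, p.2)) ρ
  have hH : ρ.fst.snd ⊗ₘ H = ρ.fst.map Prod.swap := by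
    rw [Measure.snd]
    exact compProd_map_condDistrib (by fun_prop)
  have hK : ρ.map e = (ρ.fst.snd ⊗ₘ c₀) ⊗ₘ K := by
    rw [← hc₀]
    exact (compProd_map_condDistrib (by fun_prop)).symm
  -- Read in the order `((T, V), U)`, the reference law has `U` drawn from `H` given `T` alone. The
  -- chain rule then leaves a term `K` against `H'` that does not depend on `c'`, plus the
  -- divergence of the laws of `(T, V)`, which vanishes for `c₀`.
  have key : ∀ (c' : Kernel β γ) [IsMarkovKernel c'],
      (ρ.fst ⊗ₘ c'.comap Prod.snd measurable_snd).map e = (ρ.fst.snd ⊗ₘ c') ⊗ₘ H' := by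
    intro c' _
    refine Measure.ext_of_lintegral _ fun f hf => ?_
    rw [lintegral_map hf he, Measure.lintegral_compProd (by fun_prop),
      Measure.lintegral_compProd hf, Measure.lintegral_compProd (by fun_prop)]
    simp only [e, H', Kernel.comap_apply]
    have : ∀ b, ∫⁻ v, ∫⁻ a, f ((b, v), a) ∂(H b) ∂(c' b) = ∫⁻ a, ∫⁻ v, f ((b, v), a) ∂(c' b) ∂(H b) :=
      fun b => lintegral_lintegral_swap (by fun_prop)
    simp_rw [this]
    have h1 : Measurable fun p : β × α => ∫⁻ v, f ((p.1, v), p.2) ∂(c' p.1) := by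
      have := Measurable.lintegral_kernel_prod_right' (κ := c'.comap (Prod.fst : β × α → β) measurable_fst)
        (f := fun q : (β × α) × γ => f ((q.1.1, q.2), q.1.2)) (by fun_prop)
      simpa [Kernel.comap_apply] using this
    rw [← Measure.lintegral_compProd (κ := H) (f := fun p : β × α => ∫⁻ v, f ((p.1, v), p.2) ∂(c' p.1)) h1,
      hH, lintegral_map h1 measurable_swap]
    rfl
  have hmap : ∀ (c' : Kernel β γ) [IsMarkovKernel c'],
      klDiv ρ (ρ.fst ⊗ₘ c'.comap Prod.snd measurable_snd) =
      klDiv ((ρ.fst.snd ⊗ₘ c₀) ⊗ₘ K) ((ρ.fst.snd ⊗ₘ c') ⊗ₘ H') := by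
    intro c' _
    rw [← hK, ← key c']
    refine le_antisymm ?_ (klDiv_map_le _ _ he)
    have := klDiv_map_le (ρ.map e) ((ρ.fst ⊗ₘ c'.comap Prod.snd measurable_snd).map e) he'
    rwa [Measure.map_map he' he, Measure.map_map he' he, hee', Measure.map_id, Measure.map_id] at this
  rw [hmap c₀, hmap c, klDiv_compProd_eq_add _ (ρ.fst.snd ⊗ₘ c₀) K H',
    klDiv_compProd_eq_add _ (ρ.fst.snd ⊗ₘ c) K H', klDiv_self, zero_add]
  exact self_le_add_left _ _

/-- Conditional mutual information is at most the divergence of the joint law of `((U, T), V)` from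
the law under which `V` is drawn from any kernel `c` applied to `T`. -/
theorem condMutualInfo_le_klDiv {Ω α β γ : Type*} [MeasurableSpace Ω]
    [MeasurableSpace α] [StandardBorelSpace α] [Nonempty α]
    [MeasurableSpace β] [StandardBorelSpace β] [Nonempty β] [MeasurableSpace γ]
    {U : Ω → α} {V : Ω → β} {T : Ω → γ} (hU : Measurable U) (hV : Measurable V) (hT : Measurable T)
    (μ : Measure Ω) [IsProbabilityMeasure μ] (c : Kernel γ β) [IsMarkovKernel c] :
    condMutualInfo U V T μ ≤ klDiv (μ.map fun ω => ((U ω, T ω), V ω))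
      ((μ.map fun ω => (U ω, T ω)) ⊗ₘ c.comap Prod.snd measurable_snd) := by
  have h1 : IsProbabilityMeasure (μ.map T) := Measure.isProbabilityMeasure_map hT.aemeasurable
  have h2 : IsProbabilityMeasure (μ.map fun ω => ((U ω, T ω), V ω)) :=
    Measure.isProbabilityMeasure_map (by fun_prop)
  have hfst : (μ.map fun ω => ((U ω, T ω), V ω)).fst = μ.map fun ω => (U ω, T ω) :=
    Measure.fst_map_prodMk hV
  have hsnd : (μ.map fun ω => (U ω, T ω)).snd = μ.map T := Measure.snd_map_prodMk hU
  have hle : condMutualInfo U V T μ ≤ klDiv (μ.map T ⊗ₘ condDistrib (fun ω => (U ω, V ω)) T μ)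
      (μ.map T ⊗ₘ (condDistrib U T μ ×ₖ condDistrib V T μ)) := by
    refine le_trans (le_of_eq ?_) (lintegral_klDiv_le (μ.map T) _ _)
    simp only [condMutualInfo, Kernel.prod_apply]
  refine hle.trans ?_
  have hgold := klDiv_condKernel_le (μ.map fun ω => ((U ω, T ω), V ω)) (condDistrib V T μ) c (by
    rw [hfst, hsnd, Measure.map_map (by fun_prop) (by fun_prop)]
    exact (compProd_map_condDistrib hV.aemeasurable).symm)
  rw [hfst] at hgold
  refine le_trans ?_ hgold
  have hm : Measurable fun p : (α × γ) × β => (p.1.2, (p.1.1, p.2)) := by fun_prop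
  have hA : μ.map T ⊗ₘ condDistrib (fun ω => (U ω, V ω)) T μ =
      (μ.map fun ω => ((U ω, T ω), V ω)).map fun p => (p.1.2, (p.1.1, p.2)) := by
    rw [compProd_map_condDistrib (by fun_prop), Measure.map_map hm (by fun_prop)]
    rfl
  have hB : μ.map T ⊗ₘ (condDistrib U T μ ×ₖ condDistrib V T μ) =
      ((μ.map fun ω => (U ω, T ω)) ⊗ₘ (condDistrib V T μ).comap Prod.snd measurable_snd).map
        fun p => (p.1.2, (p.1.1, p.2)) := by
    refine Measure.ext_of_lintegral _ fun f hf => ?_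
    rw [lintegral_map hf hm, Measure.lintegral_compProd (by fun_prop),
      Measure.lintegral_compProd (by fun_prop)]
    simp only [Kernel.prod_apply, Kernel.comap_apply]
    have h3 : Measurable fun p : γ × α => ∫⁻ v, f (p.1, (p.2, v)) ∂(condDistrib V T μ p.1) := by
      have := Measurable.lintegral_kernel_prod_right'
        (κ := (condDistrib V T μ).comap (Prod.fst : γ × α → γ) measurable_fst)
        (f := fun q : (γ × α) × β => f (q.1.1, (q.1.2, q.2))) (by fun_prop)
      simpa [Kernel.comap_apply] using this
    have h4 : ∀ t, ∫⁻ q, f (t, q) ∂((condDistrib U T μ t).prod (condDistrib V T μ t)) =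
        ∫⁻ u, ∫⁻ v, f (t, (u, v)) ∂(condDistrib V T μ t) ∂(condDistrib U T μ t) :=
      fun t => lintegral_prod _ (by fun_prop)
    simp_rw [h4]
    rw [← Measure.lintegral_compProd (κ := condDistrib U T μ)
      (f := fun p : γ × α => ∫⁻ v, f (p.1, (p.2, v)) ∂(condDistrib V T μ p.1)) h3,
      compProd_map_condDistrib (by fun_prop), lintegral_map h3 (by fun_prop)]
    exact (lintegral_map (h3.comp measurable_swap) (hU.prodMk hT)).symm
  have h5 : IsProbabilityMeasure (μ.map fun ω => (U ω, T ω)) :=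
    Measure.isProbabilityMeasure_map (by fun_prop)
  rw [hA, hB]
  exact klDiv_map_le _ _ hm

end Information

/-! ### Chain rule along the sample, and the bound by capacity over `n`. -/

section Chain

/-- Convention for all that follows: the additional draw sits at index `0`, and `Fin.tail` recovers
the old sample. -/
theorem pi_succ_eq_map {Z : Type*} [MeasurableSpace Z] (μ : Measure Z) [IsProbabilityMeasure μ]
    (n : ℕ) : Measure.pi (fun _ : Fin (n + 1) => μ) =
      ((Measure.pi fun _ : Fin n => μ).prod μ).map fun p => Fin.cons p.2 p.1 := by
  have h := (measurePreserving_piFinSuccAbove (fun _ : Fin (n + 1) => μ) 0).symm.map_eq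
  rw [← h, ← Measure.prod_swap, Measure.map_map (MeasurableEquiv.measurable _) measurable_swap]
  congr 1
  funext p
  simp [MeasurableEquiv.piFinSuccAbove_symm_apply, Fin.insertNthEquiv]

theorem measurable_finCons {Z : Type*} [MeasurableSpace Z] (n : ℕ) :
    Measurable fun p : (Fin n → Z) × Z => (Fin.cons p.2 p.1 : Fin (n + 1) → Z) := by
  refine measurable_pi_iff.2 fun i => ?_
  refine Fin.cases ?_ (fun j => ?_) i
  · simpa using measurable_snd
  · simpa using! (measurable_pi_apply j).comp measurable_fst

variable {W Z : Type*} [MeasurableSpace W] [MeasurableSpace Z]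
  (P : Kernel W Z) [IsMarkovKernel P] (π : ProbabilityMeasure W)

/-- The joint law of the parameter and the training sample. -/
abbrev paramSampleLaw (n : ℕ) : Measure (W × (Fin n → Z)) := (π : Measure W) ⊗ₘ iidKernel P n

/-- The joint law of the parameter, the training sample and one further observation. -/
abbrev paramSampleNextLaw (n : ℕ) : Measure ((W × (Fin n → Z)) × Z) :=
  paramSampleLaw P π n ⊗ₘ P.comap Prod.fst measurable_fst

theorem paramSampleLaw_succ (n : ℕ) : paramSampleLaw P π (n + 1) =
    (paramSampleNextLaw P π n).map fun q => (q.1.1, Fin.cons q.2 q.1.2) := by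
  have hm : Measurable fun q : (W × (Fin n → Z)) × Z =>
      (q.1.1, (Fin.cons q.2 q.1.2 : Fin (n + 1) → Z)) :=
    (measurable_fst.comp measurable_fst).prodMk ((measurable_finCons n).comp
      ((measurable_snd.comp measurable_fst).prodMk measurable_snd))
  refine Measure.ext_of_lintegral _ fun f hf => ?_
  have hfm := hf.comp hm
  rw [lintegral_map hf hm, Measure.lintegral_compProd hf, Measure.lintegral_compProd (by exact hfm),
    Measure.lintegral_compProd]
  · refine lintegral_congr fun w => ?_
    change ∫⁻ z, f (w, z) ∂(Measure.pi fun _ : Fin (n + 1) => P w) = _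
    rw [pi_succ_eq_map, lintegral_map (by fun_prop) (measurable_finCons n), lintegral_prod]
    · rfl
    · exact ((hf.comp measurable_prodMk_left).comp (measurable_finCons n)).aemeasurable
  · exact Measurable.lintegral_kernel_prod_right' (κ := P.comap Prod.fst measurable_fst) hfm

theorem map_paramSampleLaw_succ (n : ℕ) :
    (paramSampleLaw P π (n + 1)).map (fun p => ((p.1, Fin.tail p.2), p.2 0)) =
      paramSampleNextLaw P π n := by
  have hm : Measurable fun q : (W × (Fin n → Z)) × Z =>
      (q.1.1, (Fin.cons q.2 q.1.2 : Fin (n + 1) → Z)) :=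
    (measurable_fst.comp measurable_fst).prodMk ((measurable_finCons n).comp
      ((measurable_snd.comp measurable_fst).prodMk measurable_snd))
  have hm' : Measurable fun p : W × (Fin (n + 1) → Z) => ((p.1, Fin.tail p.2), p.2 0) := by
    unfold Fin.tail; fun_prop
  rw [paramSampleLaw_succ, Measure.map_map hm' hm]
  convert Measure.map_id
  funext q
  simp

theorem sampleInfo_eq (n : ℕ) : sampleInfo P n π =
    klDiv (paramSampleLaw P π n) ((π : Measure W).prod (paramSampleLaw P π n).snd) := by
  have h : (jointLaw P n π).map (fun ω => (ω.1, ω.2.1)) = paramSampleLaw P π n := by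
    refine Measure.ext_of_lintegral _ fun f hf => ?_
    rw [lintegral_map hf (by fun_prop), jointLaw, Measure.lintegral_compProd (by fun_prop),
      Measure.lintegral_compProd hf]
    refine lintegral_congr fun w => ?_
    rw [Kernel.prod_apply, lintegral_prod _ (by fun_prop)]
    simp
  have h1 : (jointLaw P n π).map (fun ω => ω.1) = π := by
    have : (jointLaw P n π).map (fun ω => ω.1) = (paramSampleLaw P π n).fst := by
      rw [← h, Measure.fst, Measure.map_map (by fun_prop) (by fun_prop)]; rfl
    rw [this, Measure.fst_compProd]
  have h2 : (jointLaw P n π).map (fun ω => ω.2.1) = (paramSampleLaw P π n).snd := by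
    rw [← h, Measure.snd, Measure.map_map (by fun_prop) (by fun_prop)]; rfl
  rw [sampleInfo, mutualInfo, h, h1, h2]

variable [StandardBorelSpace Z] [Nonempty Z]

/-- The predictive distribution of the next observation given the training sample. -/
abbrev predictive (n : ℕ) : Kernel (Fin n → Z) Z :=
  condDistrib (fun q : (W × (Fin n → Z)) × Z => q.2) (fun q => q.1.2) (paramSampleNextLaw P π n)

/-- The information `I(W; Z_{n+1} | Zⁿ)`. -/
abbrev stepInfo (n : ℕ) : ℝ≥0∞ :=
  klDiv (paramSampleNextLaw P π n)
    (paramSampleLaw P π n ⊗ₘ (predictive P π n).comap Prod.snd measurable_snd)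

theorem map_paramSampleNextLaw (n : ℕ) :
    (paramSampleNextLaw P π n).map (fun p => (p.1.2, p.2)) =
      (paramSampleLaw P π n).snd ⊗ₘ predictive P π n := by
  have h : (paramSampleLaw P π n).snd = (paramSampleNextLaw P π n).map fun q => q.1.2 := by
    conv_lhs => rw [← Measure.fst_compProd (paramSampleLaw P π n) (P.comap Prod.fst measurable_fst)]
    rw [Measure.fst, Measure.snd, Measure.map_map (by fun_prop) (by fun_prop)]; rfl
  rw [h]
  exact (compProd_map_condDistrib (by fun_prop)).symm

/-- Chain rule for `I(W;Zⁿ⁺¹)`. Only this inequality is needed, so data processing under the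
splitting of the sample into tail and head suffices. -/
theorem sampleInfo_add_stepInfo_le (n : ℕ) :
    sampleInfo P n π + stepInfo P π n ≤ sampleInfo P (n + 1) π := by
  rw [sampleInfo_eq, sampleInfo_eq, stepInfo, ← klDiv_compProd_eq_add]
  change klDiv (paramSampleNextLaw P π n) _ ≤ _
  rw [← map_paramSampleLaw_succ]
  have hm : Measurable fun p : W × (Fin (n + 1) → Z) => ((p.1, Fin.tail p.2), p.2 0) := by
    unfold Fin.tail; fun_prop
  have hm' : Measurable fun p : (Fin (n + 1) → Z) => (Fin.tail p, p 0) := by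
    unfold Fin.tail; fun_prop
  have hsnd : (paramSampleLaw P π (n + 1)).snd.map (fun p => (Fin.tail p, p 0)) =
      (paramSampleLaw P π n).snd ⊗ₘ predictive P π n := by
    rw [← map_paramSampleNextLaw, ← map_paramSampleLaw_succ, Measure.snd,
      Measure.map_map hm' (by fun_prop), Measure.map_map (by fun_prop) hm]
    rfl
  refine le_trans (le_of_eq ?_) (klDiv_map_le _ _ hm)
  congr 1
  refine Measure.ext_of_lintegral _ fun f hf => ?_
  rw [Measure.lintegral_compProd hf, lintegral_map hf hm, lintegral_prod,
    lintegral_prod _ (by exact (hf.comp hm).aemeasurable)]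
  · refine lintegral_congr fun w => ?_
    have h3 := lintegral_map (μ := (paramSampleLaw P π (n + 1)).snd)
      (f := fun p : (Fin n → Z) × Z => f ((w, p.1), p.2)) (by fun_prop) hm'
    rw [← h3, hsnd, Measure.lintegral_compProd (by fun_prop)]
    rfl
  · exact (Measurable.lintegral_kernel_prod_right'
      (κ := (predictive P π n).comap Prod.snd measurable_snd) hf).aemeasurable

variable [StandardBorelSpace W] [Nonempty W]

/-- With `n + 1` draws, the optimal predictive law is no worse than the one that ignores the draw at
index `0`; the divergence of the latter is at most the previous step, since the ignored draw is
independent of the target given `W`. -/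
theorem stepInfo_succ_le (n : ℕ) : stepInfo P π (n + 1) ≤ stepInfo P π n := by
  have hm : Measurable fun q : ((W × (Fin n → Z)) × Z) × Z =>
      ((q.1.1.1, (Fin.cons q.2 q.1.1.2 : Fin (n + 1) → Z)), q.1.2) :=
    (Measurable.prodMk (by fun_prop) ((measurable_finCons n).comp
      (Measurable.prodMk (by fun_prop) measurable_snd))).prodMk (by fun_prop)
  have hc : Measurable fun q : (W × (Fin n → Z)) × Z =>
      (q.1.1, (Fin.cons q.2 q.1.2 : Fin (n + 1) → Z)) :=
    (measurable_fst.comp measurable_fst).prodMk ((measurable_finCons n).comp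
      ((measurable_snd.comp measurable_fst).prodMk measurable_snd))
  have ht : Measurable fun p : Fin (n + 1) → Z => (Fin.tail p : Fin n → Z) := by
    unfold Fin.tail; fun_prop
  have hgold := klDiv_condKernel_le (paramSampleNextLaw P π (n + 1)) (predictive P π (n + 1))
    ((predictive P π n).comap _ ht) (by
      rw [Measure.fst_compProd]; exact map_paramSampleNextLaw P π (n + 1))
  rw [Measure.fst_compProd] at hgold
  refine hgold.trans ?_
  -- Appending a fresh draw from `P w` to both laws leaves the divergence unchanged.
  rw [stepInfo, ← klDiv_compProd_left (paramSampleNextLaw P π n) _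
    (P.comap (fun q : (W × (Fin n → Z)) × Z => q.1.1) (by fun_prop))]
  -- The fresh draw, made after the target, becomes entry `0` of the longer sample. As `c'` does not
  -- look at that entry, the two draws may be made in either order.
  have key : ∀ (c : Kernel (W × (Fin n → Z)) Z) [IsMarkovKernel c]
      (c' : Kernel (W × (Fin (n + 1) → Z)) Z) [IsMarkovKernel c']
      (_ : ∀ w z z', c' (w, Fin.cons z' z) = c (w, z)),
      paramSampleLaw P π (n + 1) ⊗ₘ c' = ((paramSampleLaw P π n ⊗ₘ c) ⊗ₘ
        (P.comap (fun q : (W × (Fin n → Z)) × Z => q.1.1) (by fun_prop))).map fun q =>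
      ((q.1.1.1, (Fin.cons q.2 q.1.1.2 : Fin (n + 1) → Z)), q.1.2) := by
    intro c _ c' _ hcc
    refine Measure.ext_of_lintegral _ fun f hf => ?_
    have hfm := hf.comp hm
    rw [lintegral_map hf hm, Measure.lintegral_compProd hf, paramSampleLaw_succ,
      lintegral_map (Measurable.lintegral_kernel_prod_right' hf) hc,
      Measure.lintegral_compProd (μ := paramSampleLaw P π n),
      Measure.lintegral_compProd (μ := paramSampleLaw P π n ⊗ₘ c) (by exact hfm),
      Measure.lintegral_compProd (μ := paramSampleLaw P π n)]
    · refine lintegral_congr fun p => ?_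
      simp only [Kernel.comap_apply, hcc]
      refine lintegral_lintegral_swap ?_
      have : Measurable fun r : Z × Z => (((p, r.2), r.1) : ((W × (Fin n → Z)) × Z) × Z) := by
        fun_prop
      exact (hfm.comp this).aemeasurable
    · exact Measurable.lintegral_kernel_prod_right'
        (κ := P.comap (fun q : (W × (Fin n → Z)) × Z => q.1.1) (by fun_prop)) hfm
    · exact (Measurable.lintegral_kernel_prod_right' hf).comp hc
  rw [paramSampleNextLaw, key (P.comap Prod.fst measurable_fst) (P.comap Prod.fst measurable_fst)
    (fun _ _ _ => rfl),
    key ((predictive P π n).comap Prod.snd measurable_snd)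
      (((predictive P π n).comap _ ht).comap Prod.snd measurable_snd)
    (fun w z z' => by simp [Kernel.comap_apply])]
  exact klDiv_map_le _ _ hm

/-- The chain rule produces `n` terms, and each is at least the term of index `n` by monotonicity.
-/
theorem nsmul_stepInfo_le_sampleInfo (n : ℕ) : n * stepInfo P π n ≤ sampleInfo P n π := by
  have hanti : Antitone (stepInfo P π) := antitone_nat_of_succ_le (stepInfo_succ_le P π)
  have : ∀ k, k * stepInfo P π k ≤ sampleInfo P k π := by
    intro k
    induction k with
    | zero => simp
    | succ k ih =>
      refine le_trans ?_ (sampleInfo_add_stepInfo_le P π k)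
      push_cast
      rw [add_mul, one_mul]
      have h := hanti (Nat.le_succ k)
      exact add_le_add ((mul_le_mul_right h _).trans ih) h
  exact this n

/-- Disintegrating the next pair into `X` and `Y` given `X`, the chain rule splits the divergence.
Discarding the part of `X` leaves the divergence of `Y` from the prediction `c.condKernel`, which
dominates the conditional mutual information for any choice of `c`. -/
theorem predictiveInfo_le_klDiv {X Y : Type*} [MeasurableSpace X] [MeasurableSpace Y]
    [StandardBorelSpace X] [Nonempty X] [StandardBorelSpace Y] [Nonempty Y]
    (P : Kernel W (X × Y)) [IsMarkovKernel P] (n : ℕ)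
    (c : Kernel (Fin n → X × Y) (X × Y)) [IsMarkovKernel c] :
    predictiveInfo P n π ≤ klDiv (paramSampleNextLaw P π n)
      (paramSampleLaw P π n ⊗ₘ c.comap Prod.snd measurable_snd) := by
  let L := paramSampleLaw P π n
  let PX : Kernel (W × (Fin n → X × Y)) X := P.fst.comap Prod.fst measurable_fst
  let PY : Kernel ((W × (Fin n → X × Y)) × X) Y :=
    P.condKernel.comap (fun q => (q.1.1, q.2)) (by fun_prop)
  let cX : Kernel (W × (Fin n → X × Y)) X := c.fst.comap Prod.snd measurable_snd
  let cY : Kernel ((W × (Fin n → X × Y)) × X) Y :=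
    c.condKernel.comap (fun q => (q.1.2, q.2)) (by fun_prop)
  let c' : Kernel (X × (Fin n → X × Y)) Y := c.condKernel.comap Prod.swap measurable_swap
  let e : (W × (Fin n → X × Y)) × (X × Y) → ((W × (Fin n → X × Y)) × X) × Y :=
    fun q => ((q.1, q.2.1), q.2.2)
  let g : ((W × (Fin n → X × Y)) × X) × Y → (W × (X × (Fin n → X × Y))) × Y :=
    fun q => ((q.1.1.1, (q.1.2, q.1.1.2)), q.2)
  have he : Measurable e := by fun_prop
  have hg : Measurable g := by fun_prop
  have hP : (L ⊗ₘ P.comap Prod.fst measurable_fst).map e = (L ⊗ₘ PX) ⊗ₘ PY := by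
    refine Measure.ext_of_lintegral _ fun f hf => ?_
    rw [lintegral_map hf he, Measure.lintegral_compProd (μ := L) (by fun_prop),
      Measure.lintegral_compProd (μ := L ⊗ₘ PX) hf, Measure.lintegral_compProd (μ := L)]
    · refine lintegral_congr fun p => ?_
      simp only [Kernel.comap_apply, PX, PY]
      conv_lhs => rw [← P.disintegrate P.condKernel]
      rw [Kernel.lintegral_compProd _ _ _ (by fun_prop)]
    · exact Measurable.lintegral_kernel_prod_right' hf
  have hc : (L ⊗ₘ c.comap Prod.snd measurable_snd).map e = (L ⊗ₘ cX) ⊗ₘ cY := by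
    refine Measure.ext_of_lintegral _ fun f hf => ?_
    rw [lintegral_map hf he, Measure.lintegral_compProd (μ := L) (by fun_prop),
      Measure.lintegral_compProd (μ := L ⊗ₘ cX) hf, Measure.lintegral_compProd (μ := L)]
    · refine lintegral_congr fun p => ?_
      simp only [Kernel.comap_apply, cX, cY]
      conv_lhs => rw [← c.disintegrate c.condKernel]
      rw [Kernel.lintegral_compProd _ _ _ (by fun_prop)]
    · exact Measurable.lintegral_kernel_prod_right' hf
  have hjoint : (jointLaw P n π).map (fun ω => ((ω.1, (ω.2.2.1, ω.2.1)), ω.2.2.2)) =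
      ((L ⊗ₘ P.comap Prod.fst measurable_fst).map e).map g := by
    rw [Measure.map_map hg he]
    refine Measure.ext_of_lintegral _ fun f hf => ?_
    rw [lintegral_map hf (by fun_prop), lintegral_map hf (by fun_prop), jointLaw,
      Measure.lintegral_compProd (by fun_prop), Measure.lintegral_compProd (by fun_prop),
      Measure.lintegral_compProd]
    · refine lintegral_congr fun w => ?_
      rw [Kernel.prod_apply, lintegral_prod _ (by fun_prop)]
      rfl
    · exact Measurable.lintegral_kernel_prod_right' (κ := P.comap Prod.fst measurable_fst)
        (f := fun q => f ((g ∘ e) q)) (by fun_prop)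
  have hfst : (jointLaw P n π).map (fun ω => (ω.1, (ω.2.2.1, ω.2.1))) =
      (L ⊗ₘ PX).map fun q => (q.1.1, (q.2, q.1.2)) := by
    have h1 : (jointLaw P n π).map (fun ω => (ω.1, (ω.2.2.1, ω.2.1))) =
        ((jointLaw P n π).map (fun ω => ((ω.1, (ω.2.2.1, ω.2.1)), ω.2.2.2))).map Prod.fst := by
      rw [Measure.map_map (by fun_prop) (by fun_prop)]; rfl
    have h2 : (L ⊗ₘ PX) = ((L ⊗ₘ PX) ⊗ₘ PY).map Prod.fst := by
      rw [← Measure.fst, Measure.fst_compProd]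
    rw [h1, hjoint, hP, Measure.map_map (by fun_prop) (by fun_prop)]
    conv_rhs => rw [h2, Measure.map_map (by fun_prop) (by fun_prop)]
    rfl
  have hsnd : ((jointLaw P n π).map (fun ω => (ω.1, (ω.2.2.1, ω.2.1)))) ⊗ₘ
      c'.comap Prod.snd measurable_snd = ((L ⊗ₘ PX) ⊗ₘ cY).map g := by
    rw [hfst]
    refine Measure.ext_of_lintegral _ fun f hf => ?_
    rw [lintegral_map hf hg, Measure.lintegral_compProd hf, lintegral_map _ (by fun_prop),
      Measure.lintegral_compProd (μ := L ⊗ₘ PX) (by fun_prop)]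
    · rfl
    · exact Measurable.lintegral_kernel_prod_right' hf
  calc predictiveInfo P n π
      ≤ klDiv (((L ⊗ₘ PX) ⊗ₘ PY).map g) (((L ⊗ₘ PX) ⊗ₘ cY).map g) := by
        rw [← hsnd, ← hP, ← hjoint]
        exact condMutualInfo_le_klDiv (by fun_prop) (by fun_prop) (by fun_prop) _ c'
    _ ≤ klDiv ((L ⊗ₘ PX) ⊗ₘ PY) ((L ⊗ₘ PX) ⊗ₘ cY) := klDiv_map_le _ _ hg
    _ ≤ klDiv ((L ⊗ₘ PX) ⊗ₘ PY) ((L ⊗ₘ cX) ⊗ₘ cY) := by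
        rw [klDiv_compProd_eq_add (L ⊗ₘ PX) (L ⊗ₘ cX)]
        exact self_le_add_left _ _
    _ ≤ _ := by
        rw [← hP, ← hc]
        exact klDiv_map_le _ _ he

theorem nsmul_predictiveInfo_le_sampleInfo {X Y : Type*} [MeasurableSpace X] [MeasurableSpace Y]
    [StandardBorelSpace X] [Nonempty X] [StandardBorelSpace Y] [Nonempty Y]
    (P : Kernel W (X × Y)) [IsMarkovKernel P] (n : ℕ) :
    n * predictiveInfo P n π ≤ sampleInfo P n π :=
  (mul_le_mul_right (predictiveInfo_le_klDiv π P n _) _).trans (nsmul_stepInfo_le_sampleInfo P π n)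

theorem worstPredictiveInfo_le_capacity_div {X Y : Type*} [MeasurableSpace X] [MeasurableSpace Y]
    [StandardBorelSpace X] [Nonempty X] [StandardBorelSpace Y] [Nonempty Y]
    (P : Kernel W (X × Y)) [IsMarkovKernel P] {n : ℕ} (hn : 1 ≤ n) :
    worstPredictiveInfo P n ≤ capacity P n / n := by
  refine iSup_le fun π => ?_
  rw [ENNReal.le_div_iff_mul_le (by simp; omega) (by simp), mul_comm]
  exact (nsmul_predictiveInfo_le_sampleInfo π P n).trans (le_iSup (sampleInfo P n) π)

end Chain

/-! ### Scalar inequalities for `klFun` and their integrated form. -/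

section Divergence

-- This is `three_mul_sq_le_klFun` solved for the logarithm. The derivative of the difference has
-- the sign of `(y - 1) ^ 3`, so its minimum is the zero at `1`.
open Real in
theorem div_le_log {x : ℝ} (hx : 0 < x) :
    (x - 1) * (5 * x + 1) / (2 * x * (x + 2)) ≤ log x := by
  set h : ℝ → ℝ := fun x => log x - (x - 1) * (5 * x + 1) / (2 * x * (x + 2)) with hh
  have hd : ∀ y : ℝ, 0 < y → HasDerivAt h ((y - 1) ^ 3 / (y ^ 2 * (y + 2) ^ 2)) y := by
    intro y hy
    have h1 : HasDerivAt (fun x : ℝ => (x - 1) * (5 * x + 1)) (10 * y - 4) y := by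
      have := ((hasDerivAt_id y).sub_const 1).mul (((hasDerivAt_id y).const_mul 5).add_const 1)
      refine this.congr_deriv ?_
      simp only [id_eq]
      ring
    have h2 : HasDerivAt (fun x : ℝ => 2 * x * (x + 2)) (4 * y + 4) y := by
      have := ((hasDerivAt_id y).const_mul 2).mul ((hasDerivAt_id y).add_const 2)
      refine this.congr_deriv ?_
      simp only [id_eq]
      ring
    have h3 := (hasDerivAt_log hy.ne').sub (h1.div h2 (by positivity))
    refine h3.congr_deriv ?_
    field_simp
    ring
  have hcont : ContinuousOn h (Set.Ioi 0) := fun y hy =>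
    (hd y hy).continuousAt.continuousWithinAt
  have h1 : h 1 = 0 := by simp [hh]
  rcases le_total 1 x with hx1 | hx1
  · have hmono : MonotoneOn h (Set.Ici 1) := by
      refine monotoneOn_of_hasDerivWithinAt_nonneg (f' := fun y => (y - 1) ^ 3 / (y ^ 2 * (y + 2) ^ 2))
        (convex_Ici 1)
        (hcont.mono fun y (hy : 1 ≤ y) => lt_of_lt_of_le one_pos hy) (fun y hy => ?_) (fun y hy => ?_)
      · rw [interior_Ici] at hy
        exact (hd y (one_pos.trans hy)).hasDerivWithinAt
      · rw [interior_Ici] at hy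
        have : 0 ≤ y - 1 := sub_nonneg.2 (le_of_lt hy)
        positivity
    have := hmono Set.self_mem_Ici hx1 hx1
    rw [h1] at this
    exact sub_nonneg.1 this
  · have hanti : AntitoneOn h (Set.Ioc 0 1) := by
      refine antitoneOn_of_hasDerivWithinAt_nonpos (f' := fun y => (y - 1) ^ 3 / (y ^ 2 * (y + 2) ^ 2))
        (convex_Ioc 0 1) (hcont.mono fun y hy => hy.1) (fun y hy => ?_) (fun y hy => ?_)
      · rw [interior_Ioc] at hy
        exact (hd y hy.1).hasDerivWithinAt
      · rw [interior_Ioc] at hy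
        have h4 : (y - 1) ^ 3 ≤ 0 := by
          have : y - 1 ≤ 0 := by linarith [hy.2]
          exact Odd.pow_nonpos (by decide) this
        exact div_nonpos_of_nonpos_of_nonneg h4 (by positivity)
    have := hanti ⟨hx, hx1⟩ ⟨one_pos, le_rfl⟩ hx1
    rw [h1] at this
    exact sub_nonneg.1 this

/-- Pointwise form of Pinsker's inequality: when `r` is a density between probability measures, the
weight `2 * r + 4` has mean `6`, and Cauchy-Schwarz gives the sharp constant. -/
theorem three_mul_sq_le_klFun {r : ℝ} (hr : 0 ≤ r) :
    3 * (r - 1) ^ 2 ≤ (2 * r + 4) * klFun r := by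
  rcases hr.eq_or_lt with rfl | hr
  · norm_num [klFun_zero]
  have h := div_le_log hr
  rw [div_le_iff₀ (by positivity)] at h
  rw [klFun_apply]
  nlinarith

/-- Pointwise Pinsker combined with the arithmetic-geometric mean inequality. The term `v * (2 * r +
4) / 6` charges one third of `v` to the law with density `r` and two thirds to the reference law. -/
theorem abs_mul_le_klFun {r u v : ℝ} (hr : 0 ≤ r) {b : ℝ} (hb : 0 ≤ b) (hu : u ^ 2 ≤ b * v) 
    (hv : 0 ≤ v) : 2 * |u * (r - 1)| ≤ v * (2 * r + 4) / 6 + 2 * b * klFun r := by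
  have hk := klFun_nonneg hr
  have h := three_mul_sq_le_klFun hr
  refine abs_le_of_sq_le_sq' ?_ (by positivity) |>.2
  have h1 : (2 * |u * (r - 1)|) ^ 2 = 4 * (u ^ 2 * (r - 1) ^ 2) := by
    rw [mul_pow, sq_abs]; ring
  rw [h1]
  have h2 : u ^ 2 * (r - 1) ^ 2 ≤ (b * v) * ((2 * r + 4) * klFun r / 3) :=
    mul_le_mul hu (by linarith) (sq_nonneg _) (by positivity)
  nlinarith [sq_nonneg (v * (2 * r + 4) / 6 - 2 * b * klFun r)]

/-- Changes measure for a nonnegative loss at a cost linear in the divergence. For `r ≥ 1 / 3` the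
last term suffices; below that, `klFun r` is bounded below by a positive multiple of `1 - 3 * r`. -/
theorem le_three_mul_klFun_add {r g b : ℝ} (hr : 0 ≤ r) (hg : 0 ≤ g) (hgb : g ≤ b) :
    g ≤ 3 * b * klFun r + 3 * (r * g) := by
  have hk := klFun_nonneg hr
  by_cases h3 : 1 / 3 ≤ r
  · nlinarith [mul_nonneg (hg.trans hgb) hk]
  push Not at h3
  have h := three_mul_sq_le_klFun hr
  have h5 : 1 - 3 * r ≤ 3 * klFun r := by
    by_contra! h6
    nlinarith
  nlinarith [mul_le_mul_of_nonneg_right h5 hg, mul_le_mul_of_nonneg_left hgb hk]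

/-- Linearization of the divergence: a lower bound of `klFun` by affine functions, integrated. -/
theorem ofReal_integral_add_le_klDiv {Ω : Type*} [MeasurableSpace Ω] (ρ η : Measure Ω)
    [IsProbabilityMeasure ρ] [IsProbabilityMeasure η] {a b : Ω → ℝ} (ha : Integrable a ρ)
    (hb : Integrable b η) (c : ℝ≥0)
    (h : ∀ ω r, 0 ≤ r → a ω * r + b ω ≤ c * klFun r) :
    ENNReal.ofReal (∫ ω, a ω ∂ρ + ∫ ω, b ω ∂η) ≤ c * klDiv ρ η := by
  rcases eq_or_ne c 0 with rfl | hc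
  -- For `c = 0` the right side is `0` even when the divergence is infinite, so both `a` and `b`
  -- must be shown nonpositive; `r = (1 - b ω) / a ω` would make the affine function equal to `1`.
  · have hb0 : ∀ ω, b ω ≤ 0 := fun ω => by simpa using h ω 0 le_rfl
    have ha0 : ∀ ω, a ω ≤ 0 := fun ω => by
      by_contra! hpos
      have := h ω ((1 - b ω) / a ω) (div_nonneg (by linarith [hb0 ω]) hpos.le)
      rw [mul_div_cancel₀ _ hpos.ne'] at this
      simp at this
      linarith
    have := add_nonpos (integral_nonpos (μ := ρ) ha0) (integral_nonpos (μ := η) hb0)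
    simp [ENNReal.ofReal_of_nonpos this]
  by_cases htop : klDiv ρ η = ∞
  · rw [htop, ENNReal.mul_top (by simpa using hc)]
    exact le_top
  obtain ⟨hac, hint⟩ := klDiv_ne_top_iff.1 htop
  have hkl : klDiv ρ η = ENNReal.ofReal (∫ x, klFun (ρ.rnDeriv η x).toReal ∂η) := by
    rw [klDiv_eq_integral_klFun, if_pos ⟨hac, hint⟩]
  rw [hkl, ← ENNReal.ofReal_coe_nnreal, ← ENNReal.ofReal_mul c.coe_nonneg, ← integral_const_mul,
    ← integral_rnDeriv_smul hac]
  have hra := (integrable_rnDeriv_smul_iff hac).2 ha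
  rw [← integral_add hra hb]
  refine ENNReal.ofReal_le_ofReal (integral_mono (hra.add hb)
    (((integrable_klFun_rnDeriv_iff hac).2 hint).const_mul _) fun ω => ?_)
  have := h ω _ (ENNReal.toReal_nonneg (a := ρ.rnDeriv η ω))
  simpa [mul_comm] using this

theorem ofReal_integral_le_lintegral_ofReal {Ω : Type*} [MeasurableSpace Ω] (μ : Measure Ω)
    (f : Ω → ℝ) : ENNReal.ofReal (∫ ω, f ω ∂μ) ≤ ∫⁻ ω, ENNReal.ofReal (f ω) ∂μ := by
  by_cases hf : Integrable f μ
  · calc ENNReal.ofReal (∫ ω, f ω ∂μ) ≤ ENNReal.ofReal (∫ ω, max (f ω) 0 ∂μ) :=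
        ENNReal.ofReal_le_ofReal (integral_mono hf hf.pos_part fun ω => le_max_left _ _)
      _ = ∫⁻ ω, ENNReal.ofReal (max (f ω) 0) ∂μ :=
        ofReal_integral_eq_lintegral_ofReal hf.pos_part (ae_of_all _ fun ω => le_max_right _ _)
      _ = _ := by simp [ENNReal.ofReal_max]
  · simp [integral_undef hf]

end Divergence

/-! ### Change of measure from the conditional joint law to the product law. -/

section Conditional

theorem integrable_integral_kernel {γ δ : Type*} [MeasurableSpace γ] [MeasurableSpace δ]
    (κ : Kernel γ δ) [IsMarkovKernel κ] (ν : Measure γ)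
    [IsFiniteMeasure ν] {f : γ × δ → ℝ} (hf : Measurable f) {C : ℝ} (hC : ∀ p, |f p| ≤ C) :
    Integrable (fun t => ∫ p, f (t, p) ∂(κ t)) ν := by
  refine .of_bound hf.stronglyMeasurable.integral_kernel_prod_right'.aestronglyMeasurable C
    (ae_of_all _ fun t => ?_)
  simpa using norm_integral_le_of_norm_le_const (μ := κ t) (f := fun p => f (t, p)) (C := C)
    (ae_of_all _ fun p => hC (t, p))

variable {Ω α β γ : Type*} [MeasurableSpace Ω]
    [MeasurableSpace α] [StandardBorelSpace α] [Nonempty α]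
    [MeasurableSpace β] [StandardBorelSpace β] [Nonempty β] [MeasurableSpace γ]
    {U : Ω → α} {V : Ω → β} {T : Ω → γ} 
    (μ : Measure Ω) [IsProbabilityMeasure μ]

theorem integral_integral_condDistrib (hV : Measurable V) (hT : Measurable T) {f : γ × β → ℝ}
    (hf : Measurable f) {C : ℝ} (hC : ∀ p, |f p| ≤ C) :
    ∫ t, ∫ v, f (t, v) ∂(condDistrib V T μ t) ∂(μ.map T) = ∫ ω, f (T ω, V ω) ∂μ := by
  have : IsProbabilityMeasure (μ.map T) := Measure.isProbabilityMeasure_map hT.aemeasurable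
  rw [← Measure.integral_compProd (.of_bound hf.aestronglyMeasurable C (ae_of_all _ hC)),
    compProd_map_condDistrib hV.aemeasurable,
    integral_map (hT.prodMk hV).aemeasurable hf.aestronglyMeasurable]

/-- The product of the conditional distributions of `U` and `V` given `T`. -/
abbrev condProd (U : Ω → α) (V : Ω → β) (T : Ω → γ) (μ : Measure Ω) [IsFiniteMeasure μ] :
    Kernel γ (α × β) := condDistrib U T μ ×ₖ condDistrib V T μ

/-- Decoupling `U` from `V` does not alter the law of `(T, U)`. -/
theorem integral_condProd_fst (hU : Measurable U) (hT : Measurable T) {f : γ × α → ℝ}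
    (hf : Measurable f) {C : ℝ} (hC : ∀ p, |f p| ≤ C) :
    ∫ t, ∫ p, f (t, p.1) ∂(condProd U V T μ t) ∂(μ.map T) = ∫ ω, f (T ω, U ω) ∂μ := by
  rw [← integral_integral_condDistrib μ hU hT hf hC]
  refine integral_congr_ae (ae_of_all _ fun t => ?_)
  simp only [Kernel.prod_apply]
  rw [integral_fun_fst (fun u => f (t, u))]
  simp

/-- A lower bound of the conditional mutual information by linearization. -/
theorem ofReal_integral_add_le_condMutualInfo (hU : Measurable U) (hV : Measurable V)
    (hT : Measurable T) {a b : γ × (α × β) → ℝ} (ha : Measurable a) (hb : Measurable b)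
    {C : ℝ} (haC : ∀ p, |a p| ≤ C) (hbC : ∀ p, |b p| ≤ C) (c : ℝ≥0)
    (h : ∀ p r, 0 ≤ r → a p * r + b p ≤ c * klFun r) :
    ENNReal.ofReal (∫ ω, a (T ω, (U ω, V ω)) ∂μ +
      ∫ t, ∫ p, b (t, p) ∂(condProd U V T μ t) ∂(μ.map T)) ≤ c * condMutualInfo U V T μ := by
  have : IsProbabilityMeasure (μ.map T) := Measure.isProbabilityMeasure_map hT.aemeasurable
  rw [← integral_integral_condDistrib μ (hU.prodMk hV) hT ha haC, ← integral_add
    (integrable_integral_kernel _ _ ha haC) (integrable_integral_kernel _ _ hb hbC)]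
  refine (ofReal_integral_le_lintegral_ofReal _ _).trans ?_
  rw [condMutualInfo, ← lintegral_const_mul' _ _ ENNReal.coe_ne_top]
  refine lintegral_mono fun t => ?_
  simp only [Kernel.prod_apply]
  refine ofReal_integral_add_le_klDiv _ _
    (.of_bound (ha.comp measurable_prodMk_left).aestronglyMeasurable C (ae_of_all _ fun _ => haC _))
    (.of_bound (hb.comp measurable_prodMk_left).aestronglyMeasurable C (ae_of_all _ fun _ => hbC _))
    c fun p r hr => h _ r hr

/-- Measurable selection of a minimizer among finitely many functions. -/
theorem exists_measurable_argmin {ι : Type*} [MeasurableSpace ι] [MeasurableSingletonClass ι]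
    [Finite ι] [Nonempty ι] {φ : ι → γ → ℝ} (hφ : ∀ i, Measurable (φ i)) :
    ∃ s : γ → ι, Measurable s ∧ ∀ t i, φ (s t) t ≤ φ i t := by
  classical
  have := Fintype.ofFinite ι
  have key : ∀ S : Finset ι, S.Nonempty →
      ∃ s : γ → ι, Measurable s ∧ ∀ t, ∀ i ∈ S, φ (s t) t ≤ φ i t := by
    intro S hS
    induction hS using Finset.Nonempty.cons_induction with
    | singleton a => exact ⟨fun _ => a, measurable_const, fun t i hi => by simp_all⟩
    | cons a S ha hS ih =>
      obtain ⟨s, hs, hmin⟩ := ih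
      have hms : Measurable fun t => φ (s t) t :=
        (measurable_from_prod_countable_left (f := fun p : γ × ι => φ p.2 p.1) hφ).comp
          (measurable_id.prodMk hs)
      refine ⟨fun t => if φ a t ≤ φ (s t) t then a else s t,
        Measurable.ite (measurableSet_le (hφ a) hms) measurable_const hs, fun t i hi => ?_⟩
      rcases Finset.mem_cons.1 hi with rfl | hi
      · beta_reduce
        split_ifs with h
        · rfl
        · exact (not_le.1 h).le
      · beta_reduce
        split_ifs with h
        · exact h.trans (hmin t i hi)
        · exact hmin t i hi
  obtain ⟨s, hs, h⟩ := key Finset.univ Finset.univ_nonempty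
  exact ⟨s, hs, fun t i => h t i (Finset.mem_univ i)⟩

/-- Among finitely many predictors, the one of least conditional risk is at least as good as
following the recommendation of an independent copy of `U`. -/
theorem exists_selector_integral_le {ι : Type*} [MeasurableSpace ι] [MeasurableSingletonClass ι]
    [Finite ι] [Nonempty ι] (hV : Measurable V)
    (hT : Measurable T) {h : ι → γ × β → ℝ} (hh : ∀ i, Measurable (h i)) {C : ℝ}
    (hC : ∀ i p, |h i p| ≤ C) {l : α → ι} (hl : Measurable l) :
    ∃ s : γ → ι, Measurable s ∧ ∫ ω, h (s (T ω)) (T ω, V ω) ∂μ ≤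
      ∫ t, ∫ p, h (l p.1) (t, p.2) ∂(condProd U V T μ t) ∂(μ.map T) := by
  have : IsProbabilityMeasure (μ.map T) := Measure.isProbabilityMeasure_map hT.aemeasurable
  have hhm : Measurable fun q : (γ × β) × ι => h q.2 q.1 :=
    measurable_from_prod_countable_left hh
  obtain ⟨s, hs, hmin⟩ := exists_measurable_argmin
    (φ := fun i t => ∫ v, h i (t, v) ∂(condDistrib V T μ t))
    (fun i => (hh i).stronglyMeasurable.integral_condDistrib.measurable)
  refine ⟨s, hs, ?_⟩
  have hf1 : Measurable fun q : γ × β => h (s q.1) q := 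
    hhm.comp (measurable_id.prodMk (hs.comp measurable_fst))
  have hf2 : Measurable fun q : γ × (α × β) => h (l q.2.1) (q.1, q.2.2) := 
    hhm.comp (Measurable.prodMk (by fun_prop) (by fun_prop))
  rw [← integral_integral_condDistrib μ hV hT hf1 (C := C) fun p => hC _ _]
  refine integral_mono 
    (integrable_integral_kernel _ _ hf1 (C := C) fun p => hC _ _)
    (integrable_integral_kernel _ _ hf2 (C := C) fun p => hC _ _) fun t => ?_
  simp only [Kernel.prod_apply]
  have hint : Integrable (fun p : α × β => h (l p.1) (t, p.2))
      ((condDistrib U T μ t).prod (condDistrib V T μ t)) :=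
    .of_bound (hf2.comp measurable_prodMk_left).aestronglyMeasurable C (ae_of_all _ fun _ => hC _ _)
  rw [integral_prod _ hint]
  calc _ = ∫ _, ∫ v, h (s t) (t, v) ∂(condDistrib V T μ t) ∂(condDistrib U T μ t) := by simp
    _ ≤ _ := integral_mono (integrable_const _) hint.integral_prod_left fun u => hmin t (l u)

end Conditional

/-! ### Bayes algorithms for bounded losses. -/

section Bayes

variable {W X Y : Type*} [MeasurableSpace W] [MeasurableSpace X] [MeasurableSpace Y]
    (P : Kernel W (X × Y)) [IsMarkovKernel P] {n : ℕ} (π : ProbabilityMeasure W)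

theorem integral_jointLaw_predict {ℓ : Y → Y → ℝ} (hℓ : Measurable (Function.uncurry ℓ)) {C : ℝ}
    (hC : ∀ y y', |ℓ y y'| ≤ C) (A : LearningAlgorithm n X Y) :
    ∫ ω, ℓ (A.predict (ω.2.1, ω.2.2.1)) ω.2.2.2 ∂(jointLaw P n π) =
      ∫ w, expectedLoss P ℓ A w ∂(π : Measure W) := by
  have hm : Measurable fun ω : W × ((Fin n → X × Y) × (X × Y)) =>
      ℓ (A.predict (ω.2.1, ω.2.2.1)) ω.2.2.2 :=
    hℓ.comp (Measurable.prodMk (A.measurable_predict.comp (by fun_prop)) (by fun_prop))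
  rw [jointLaw, Measure.integral_compProd
    (.of_bound hm.aestronglyMeasurable C (ae_of_all _ fun _ => hC _ _))]
  simp only [Kernel.prod_apply]
  rfl

theorem integral_jointLaw_oracle {ℓ : Y → Y → ℝ} {C : ℝ}
    (hC : ∀ y y', |ℓ y y'| ≤ C) {g : W × X → Y}
    (hm : Measurable fun ω : W × (X × Y) => ℓ (g (ω.1, ω.2.1)) ω.2.2) :
    ∫ ω, ℓ (g (ω.1, ω.2.2.1)) ω.2.2.2 ∂(jointLaw P n π) =
      ∫ w, ∫ z, ℓ (g (w, z.1)) z.2 ∂(P w) ∂(π : Measure W) := by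
  have hm' : Measurable fun ω : W × ((Fin n → X × Y) × (X × Y)) =>
      ℓ (g (ω.1, ω.2.2.1)) ω.2.2.2 := by
    have hp : Measurable fun ω : W × ((Fin n → X × Y) × (X × Y)) => (ω.1, ω.2.2) := by fun_prop
    exact hm.comp hp
  rw [jointLaw, Measure.integral_compProd
    (.of_bound hm'.aestronglyMeasurable C (ae_of_all _ fun _ => hC _ _))]
  refine integral_congr_ae (ae_of_all _ fun w => ?_)
  simp only [Kernel.prod_apply]
  rw [integral_fun_snd (fun z : X × Y => ℓ (g (w, z.1)) z.2)]
  simp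

theorem measurable_labelled_predictor {ι : Type*} [MeasurableSpace ι] [MeasurableSingletonClass ι]
    [Finite ι] {F : ι → X → Y} (hF : ∀ i, Measurable (F i)) {l : W → ι} (hl : Measurable l) :
    Measurable fun p : W × X => F (l p.1) p.2 :=
  (measurable_from_prod_countable_left (f := fun q : X × ι => F q.2 q.1) hF).comp
    (measurable_snd.prodMk (hl.comp measurable_fst))

variable [StandardBorelSpace W] [Nonempty W] [StandardBorelSpace Y] [Nonempty Y]
  {ι : Type*} [MeasurableSpace ι] [MeasurableSingletonClass ι] [Finite ι] [Nonempty ι]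
  {F : ι → X → Y} {l : W → ι}

/-- A deterministic algorithm that does at least as well as the label-dependent predictors `F`
applied to an independent copy of the parameter, drawn from its posterior. -/
theorem exists_algorithm_le (hF : ∀ i, Measurable (F i)) (hl : Measurable l)
    {ℓ : Y → Y → ℝ} (hℓ : Measurable (Function.uncurry ℓ)) {C : ℝ}
    (hC : ∀ y y', |ℓ y y'| ≤ C) :
    ∃ A : LearningAlgorithm n X Y, ∫ w, expectedLoss P ℓ A w ∂(π : Measure W) ≤
      ∫ t, ∫ p, ℓ (F (l p.1) t.1) p.2 ∂(condProd (fun ω => ω.1) (fun ω => ω.2.2.2)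
        (fun ω => (ω.2.2.1, ω.2.1)) (jointLaw P n π) t)
        ∂((jointLaw P n π).map fun ω => (ω.2.2.1, ω.2.1)) := by
  obtain ⟨s, hs, hle⟩ := exists_selector_integral_le (jointLaw P n π)
    (U := fun ω => ω.1) (V := fun ω => ω.2.2.2) (T := fun ω => (ω.2.2.1, ω.2.1))
    (by fun_prop) (by fun_prop) (h := fun i q => ℓ (F i q.1.1) q.2)
    (fun i => hℓ.comp (Measurable.prodMk ((hF i).comp (by fun_prop)) (by fun_prop)))
    (fun i p => hC _ _) hl
  have hA : Measurable fun q : (Fin n → X × Y) × X => F (s (q.2, q.1)) q.2 :=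
    (measurable_from_prod_countable_left (f := fun q : X × ι => F q.2 q.1) hF).comp
      (measurable_snd.prodMk (hs.comp measurable_swap))
  refine ⟨⟨_, hA⟩, ?_⟩
  rw [← integral_jointLaw_predict P π hℓ hC]
  exact hle

/-- The slopes `-3` and `1` come from `le_three_mul_klFun_add`. The factor `3` on the oracle risk is
harmless when that risk is nearly zero. -/
theorem exists_bayes_of_realizable (hF : ∀ i, Measurable (F i)) (hl : Measurable l)
    {ℓ : Y → Y → ℝ} (hℓ : Measurable (Function.uncurry ℓ)) {B : ℝ≥0}
    (hB : ∀ y y', 0 ≤ ℓ y y' ∧ ℓ y y' ≤ B) :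
    ∃ A : LearningAlgorithm n X Y, ENNReal.ofReal (∫ w, expectedLoss P ℓ A w ∂(π : Measure W) -
      3 * ∫ w, ∫ z, ℓ (F (l w) z.1) z.2 ∂(P w) ∂(π : Measure W)) ≤
        3 * B * predictiveInfo P n π := by
  have hC : ∀ y y', |ℓ y y'| ≤ (B : ℝ) := fun y y' => by
    rw [abs_of_nonneg (hB y y').1]; exact (hB y y').2
  obtain ⟨A, hA⟩ := exists_algorithm_le (n := n) P π hF hl hℓ hC
  refine ⟨A, ?_⟩
  have hg : Measurable fun q : (X × (Fin n → X × Y)) × (W × Y) => ℓ (F (l q.2.1) q.1.1) q.2.2 :=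
    hℓ.comp (((measurable_labelled_predictor hF hl).comp (f := fun q : (X × (Fin n → X × Y)) × (W × Y)
      => (q.2.1, q.1.1)) (by fun_prop)).prodMk (by fun_prop))
  have key := ofReal_integral_add_le_condMutualInfo (jointLaw P n π)
    (U := fun ω => ω.1) (V := fun ω => ω.2.2.2) (T := fun ω => (ω.2.2.1, ω.2.1))
    (by fun_prop) (by fun_prop) (by fun_prop)
    (a := fun q => -3 * ℓ (F (l q.2.1) q.1.1) q.2.2) (b := fun q => ℓ (F (l q.2.1) q.1.1) q.2.2)
    (hg.const_mul _) hg (C := 3 * B)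
    (fun p => by
      rw [abs_mul]; norm_num
      exact hC _ _)
    (fun p => (hC _ _).trans (by linarith [B.coe_nonneg])) (3 * B)
    (fun p r hr => by
      have := le_three_mul_klFun_add hr (hB (F (l p.2.1) p.1.1) p.2.2).1
        (hB (F (l p.2.1) p.1.1) p.2.2).2
      push_cast
      linarith)
  push_cast at key
  refine le_trans (ENNReal.ofReal_le_ofReal ?_) key
  rw [integral_const_mul, integral_jointLaw_oracle P π hC (g := fun p => F (l p.1) p.2)
    (hℓ.comp (((measurable_labelled_predictor hF hl).comp (f := fun ω : W × (X × Y) =>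
      (ω.1, ω.2.1)) (by fun_prop)).prodMk (by fun_prop)))]
  linarith

/-- Pinsker's inequality with the square root linearised by a free parameter; `τ = √(I / 2)`
balances `B * τ / 2` against `B / (4 * τ) * I` and gives `B * √(I / 2)`. -/
theorem exists_bayes_of_bounded (hF : ∀ i, Measurable (F i)) (hl : Measurable l)
    {ℓ : Y → Y → ℝ} (hℓ : Measurable (Function.uncurry ℓ)) {B : ℝ≥0}
    (hB : ∀ y y', 0 ≤ ℓ y y' ∧ ℓ y y' ≤ B) {τ : ℝ≥0} (hτ : 0 < τ) :
    ∃ A : LearningAlgorithm n X Y, ENNReal.ofReal (∫ w, expectedLoss P ℓ A w ∂(π : Measure W) -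
      ∫ w, ∫ z, ℓ (F (l w) z.1) z.2 ∂(P w) ∂(π : Measure W) - B * τ / 2) ≤
        (B / (4 * τ) : ℝ≥0) * predictiveInfo P n π := by
  have hC : ∀ y y', |ℓ y y'| ≤ (B : ℝ) := fun y y' => by
    rw [abs_of_nonneg (hB y y').1]; exact (hB y y').2
  have hτ' : (0 : ℝ) < τ := hτ
  have hB' := B.coe_nonneg
  obtain ⟨A, hA⟩ := exists_algorithm_le (n := n) P π hF hl hℓ hC
  refine ⟨A, ?_⟩
  have hg : Measurable fun q : (X × (Fin n → X × Y)) × (W × Y) => ℓ (F (l q.2.1) q.1.1) q.2.2 :=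
    hℓ.comp (((measurable_labelled_predictor hF hl).comp (f := fun q : (X × (Fin n → X × Y)) × (W × Y)
      => (q.2.1, q.1.1)) (by fun_prop)).prodMk (by fun_prop))
  have hg' : Measurable fun ω : W × ((Fin n → X × Y) × (X × Y)) =>
      ℓ (F (l ω.1) ω.2.2.1) ω.2.2.2 :=
    hg.comp (g := fun q : (X × (Fin n → X × Y)) × (W × Y) => ℓ (F (l q.2.1) q.1.1) q.2.2)
      (f := fun ω : W × ((Fin n → X × Y) × (X × Y)) => ((ω.2.2.1, ω.2.1), (ω.1, ω.2.2.2)))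
      (by fun_prop)
  have hbd : ∀ (q : (X × (Fin n → X × Y)) × (W × Y)), |ℓ (F (l q.2.1) q.1.1) q.2.2 - B / 2| ≤ B / 2 :=
    fun q => by
      have := hB (F (l q.2.1) q.1.1) q.2.2
      rw [abs_le]; constructor <;> linarith
  have hBτ : 0 ≤ B * τ := by positivity
  have hBτ' : (0 : ℝ) ≤ B * τ := by positivity
  -- Centring the loss at `B / 2` halves its sup norm. The offsets `B * τ / 6` and `B * τ / 3` are
  -- half of the shares one third and two thirds of `v = B * τ` in `abs_mul_le_klFun`.
  have key := ofReal_integral_add_le_condMutualInfo (jointLaw P n π)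
    (U := fun ω => ω.1) (V := fun ω => ω.2.2.2) (T := fun ω => (ω.2.2.1, ω.2.1))
    (by fun_prop) (by fun_prop) (by fun_prop)
    (a := fun q => -(ℓ (F (l q.2.1) q.1.1) q.2.2 - B / 2) - B * τ / 6)
    (b := fun q => (ℓ (F (l q.2.1) q.1.1) q.2.2 - B / 2) - B * τ / 3)
    ((hg.sub_const _).neg.sub_const _) ((hg.sub_const _).sub_const _) (C := B / 2 + B * τ)
    (fun p => by
      have := abs_le.1 (hbd p)
      rw [abs_le]; constructor <;> linarith)
    (fun p => by
      have := abs_le.1 (hbd p)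
      rw [abs_le]; constructor <;> linarith) (B / (4 * τ))
    (fun p r hr => by
      set g := ℓ (F (l p.2.1) p.1.1) p.2.2 - B / 2 with hgdef
      have hgb : |g| ≤ B / 2 := hbd p
      have h1 := abs_mul_le_klFun (r := r) (u := g) (v := B * τ) (b := B / (4 * τ)) hr
        (by positivity) (by
          have : (B : ℝ) / (4 * τ) * (B * τ) = (B / 2) ^ 2 := by field_simp; norm_num
          rw [this]
          exact sq_le_sq' (by linarith [(abs_le.1 hgb).1]) (abs_le.1 hgb).2) hBτ'
      have h2 := neg_abs_le (g * (r - 1))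
      push_cast
      linarith)
  refine le_trans (ENNReal.ofReal_le_ofReal ?_) key
  have h1 : ∫ ω, (-(ℓ (F (l ω.1) ω.2.2.1) ω.2.2.2 - B / 2) - B * τ / 6) ∂(jointLaw P n π) =
      -(∫ w, ∫ z, ℓ (F (l w) z.1) z.2 ∂(P w) ∂(π : Measure W)) + B / 2 - B * τ / 6 := by
    have hi : Integrable (fun ω => ℓ (F (l ω.1) ω.2.2.1) ω.2.2.2) (jointLaw P n π) :=
      .of_bound hg'.aestronglyMeasurable B (ae_of_all _ fun _ => hC _ _)
    rw [integral_sub (by exact (hi.sub (integrable_const _)).neg) (integrable_const _),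
      integral_neg, integral_sub hi (integrable_const _),
      integral_jointLaw_oracle P π hC (g := fun p => F (l p.1) p.2)
      (hℓ.comp (((measurable_labelled_predictor hF hl).comp (f := fun ω : W × (X × Y) =>
        (ω.1, ω.2.1)) (by fun_prop)).prodMk (by fun_prop)))]
    simp
    ring
  have h2 : ∫ t, ∫ p, ((ℓ (F (l p.1) t.1) p.2 - B / 2) - B * τ / 3) ∂(condProd (fun ω => ω.1)
        (fun ω => ω.2.2.2) (fun ω => (ω.2.2.1, ω.2.1)) (jointLaw P n π) t)
        ∂((jointLaw P n π).map fun ω => (ω.2.2.1, ω.2.1)) =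
      ∫ t, ∫ p, ℓ (F (l p.1) t.1) p.2 ∂(condProd (fun ω => ω.1) (fun ω => ω.2.2.2)
        (fun ω => (ω.2.2.1, ω.2.1)) (jointLaw P n π) t)
        ∂((jointLaw P n π).map fun ω => (ω.2.2.1, ω.2.1)) - B / 2 - B * τ / 3 := by
    have : IsProbabilityMeasure ((jointLaw P n π).map fun ω => (ω.2.2.1, ω.2.1)) :=
      Measure.isProbabilityMeasure_map (by fun_prop)
    have hin : ∀ t, ∫ p, ((ℓ (F (l p.1) t.1) p.2 - B / 2) - B * τ / 3) ∂(condProd (fun ω => ω.1)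
        (fun ω => ω.2.2.2) (fun ω => (ω.2.2.1, ω.2.1)) (jointLaw P n π) t) =
        ∫ p, ℓ (F (l p.1) t.1) p.2 ∂(condProd (fun ω => ω.1)
        (fun ω => ω.2.2.2) (fun ω => (ω.2.2.1, ω.2.1)) (jointLaw P n π) t) - (B / 2 + B * τ / 3) := by
      intro t
      simp_rw [sub_sub]
      have hgt : Measurable fun p : W × Y => ℓ (F (l p.1) t.1) p.2 :=
        hg.comp measurable_prodMk_left
      rw [integral_sub (.of_bound hgt.aestronglyMeasurable B (ae_of_all _ fun _ => hC _ _))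
        (integrable_const _)]
      simp
    simp_rw [hin]
    rw [integral_sub (integrable_integral_kernel _ _ hg (C := B) fun _ => hC _ _)
      (integrable_const _)]
    simp
    ring
  rw [h1, h2]
  linarith

end Bayes

/-! ### The posterior mean under squared loss. -/

section Quadratic

open scoped RealInnerProductSpace

/-- With `m` the posterior mean and `d = m - F`, one has `‖m - v‖² - ‖F - v‖² = 2⟪d, m - v⟫ - ‖d‖²`.
Replacing `v` by `m` in `⟪d, v⟫` is a change from the joint to the product law, and its error is
controlled by `‖d‖²` and the divergence; the negative square pays for the former. -/
theorem exists_bayes_of_quadratic {W X : Type*} [MeasurableSpace W] [StandardBorelSpace W]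
    [Nonempty W] [MeasurableSpace X]
    {E : Type*} [NormedAddCommGroup E] [InnerProductSpace ℝ E] [CompleteSpace E]
    [MeasurableSpace E] [BorelSpace E] [SecondCountableTopology E]
    {Y : Set E} [StandardBorelSpace Y] [Nonempty Y]
    (hYc : Convex ℝ Y) {y₀ : E} (hy₀ : y₀ ∈ interior Y)
    {B : ℝ≥0} (hB : ∀ y ∈ Y, ‖y‖ ^ 2 ≤ (B : ℝ))
    (P : Kernel W (X × Y)) [IsMarkovKernel P] {n : ℕ} (π : ProbabilityMeasure W)
    {ι : Type*} [MeasurableSpace ι] [MeasurableSingletonClass ι] [Finite ι]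
    {F : ι → X → Y} {l : W → ι} (hF : ∀ i, Measurable (F i)) (hl : Measurable l)
    {ℓ : Y → Y → ℝ} (hℓ : ∀ y y' : Y, ℓ y y' = ‖(y : E) - y'‖ ^ 2)
    {ε : ℝ} (hε : 0 < ε) (hε1 : ε ≤ 1) :
    ∃ A : LearningAlgorithm n X Y, ENNReal.ofReal (∫ w, expectedLoss P ℓ A w ∂(π : Measure W) -
      ∫ w, ∫ z, ℓ (F (l w) z.1) z.2 ∂(P w) ∂(π : Measure W) - 4 * B * ε) ≤
        2 * B * predictiveInfo P n π := by
  let T : W × ((Fin n → X × Y) × (X × Y)) → X × (Fin n → X × Y) := fun ω => (ω.2.2.1, ω.2.1)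
  let V : W × ((Fin n → X × Y) × (X × Y)) → Y := fun ω => ω.2.2.2
  let U : W × ((Fin n → X × Y) × (X × Y)) → W := fun ω => ω.1
  have hT : Measurable T := by fun_prop
  have hV : Measurable V := by fun_prop
  have hU : Measurable U := by fun_prop
  set μ := jointLaw P n π with hμ
  set b : ℝ := Real.sqrt B with hb
  have hb0 : 0 ≤ b := Real.sqrt_nonneg _
  have hbB : b * b = B := Real.mul_self_sqrt B.coe_nonneg
  have hnorm : ∀ y ∈ Y, ‖y‖ ≤ b := fun y hy => Real.le_sqrt_of_sq_le (hB y hy)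
  let m : X × (Fin n → X × Y) → E := fun t => ∫ v : Y, (v : E) ∂(condDistrib V T μ t)
  have hmm : Measurable m :=
    (StronglyMeasurable.integral_condDistrib (f := fun p : (X × (Fin n → X × Y)) × Y => (p.2 : E))
      (measurable_subtype_coe.comp measurable_snd).stronglyMeasurable).measurable
  have hint : ∀ t, Integrable (fun v : Y => (v : E)) (condDistrib V T μ t) := fun t =>
    .of_bound measurable_subtype_coe.aestronglyMeasurable b (ae_of_all _ fun v => hnorm v v.2)
  have hmcl : ∀ t, m t ∈ closure Y := fun t =>
    hYc.closure.integral_mem isClosed_closure (ae_of_all _ fun v => subset_closure v.2) (hint t)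
  have hmb : ∀ t, ‖m t‖ ≤ b := fun t => by
    simpa using norm_integral_le_of_norm_le_const (μ := condDistrib V T μ t)
      (f := fun v : Y => (v : E)) (C := b) (ae_of_all _ fun v => hnorm v v.2)
  -- The mean has only been placed in `closure Y`; a small step towards an interior point brings it
  -- into `Y`, at a cost of at most `4 * B * ε`.
  have hAmem : ∀ t, (1 - ε) • m t + ε • y₀ ∈ Y := fun t =>
    interior_subset (hYc.combo_closure_interior_mem_interior (hmcl t) hy₀ (by linarith) hε
      (by ring))
  have hA : Measurable fun q : (Fin n → X × Y) × X =>
      (⟨(1 - ε) • m (q.2, q.1) + ε • y₀, hAmem _⟩ : Y) :=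
    (((hmm.comp measurable_swap).const_smul _).add_const _).subtype_mk
  have hℓm : Measurable (Function.uncurry ℓ) := by
    have : Function.uncurry ℓ = fun p : Y × Y => ‖(p.1 : E) - p.2‖ ^ 2 := by
      funext p; exact hℓ _ _
    rw [this]
    fun_prop
  have hsq : ∀ u v : E, ‖u‖ ≤ b → ‖v‖ ≤ b → ‖u - v‖ ^ 2 ≤ 4 * B := fun u v hu hv => by
    have h1 : ‖u - v‖ ≤ 2 * b := (norm_sub_le u v).trans (by linarith)
    nlinarith [norm_nonneg (u - v)]
  have hℓC : ∀ y y' : Y, |ℓ y y'| ≤ 4 * B := fun y y' => by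
    rw [hℓ, abs_of_nonneg (sq_nonneg _)]
    exact hsq _ _ (hnorm _ y.2) (hnorm _ y'.2)
  let d : (X × (Fin n → X × Y)) × W → E := fun q => m q.1 - F (l q.2) q.1.1
  have hdm : Measurable d := by
    have := (measurable_labelled_predictor hF hl).comp (f := fun q : (X × (Fin n → X × Y)) × W =>
      (q.2, q.1.1)) (by fun_prop)
    exact (hmm.comp measurable_fst).sub (measurable_subtype_coe.comp this)
  have hdb : ∀ q, ‖d q‖ ^ 2 ≤ 4 * B := fun q => hsq _ _ (hmb _) (hnorm _ (F _ _).2)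
  have hinner : ∀ q (v : E), ‖v‖ ≤ b → ⟪d q, v⟫ ^ 2 ≤ B * ‖d q‖ ^ 2 := fun q v hv => by
    have h1 := abs_real_inner_le_norm (d q) v
    have h2 : ‖d q‖ * ‖v‖ ≤ ‖d q‖ * b := by gcongr
    have h3 : ⟪d q, v⟫ ^ 2 ≤ (‖d q‖ * b) ^ 2 := sq_le_sq' (by linarith [neg_abs_le ⟪d q, v⟫])
      ((le_abs_self _).trans (h1.trans h2))
    nlinarith
  have hinnerb : ∀ q (v : E), ‖v‖ ≤ b → |⟪d q, v⟫| ≤ 2 * B := fun q v hv => by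
    refine abs_le_of_sq_le_sq ?_ (by positivity)
    nlinarith [hinner q v hv, hdb q, B.coe_nonneg]
  have hψ : Measurable fun q : (X × (Fin n → X × Y)) × (W × Y) => ⟪d (q.1, q.2.1), (q.2.2 : E)⟫ :=
    (hdm.comp (f := fun q : (X × (Fin n → X × Y)) × (W × Y) => (q.1, q.2.1)) (by fun_prop)).inner
      (by fun_prop)
  have hd2 : Measurable fun q : (X × (Fin n → X × Y)) × (W × Y) => ‖d (q.1, q.2.1)‖ ^ 2 :=
    (hdm.comp (f := fun q : (X × (Fin n → X × Y)) × (W × Y) => (q.1, q.2.1))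
      (by fun_prop)).norm.pow_const 2
  have hB0 := B.coe_nonneg
  -- `abs_mul_le_klFun` is used with `u = ⟪d, v⟫`, `v = ‖d‖ ^ 2` and `b = B`, whence the split of
  -- `‖d‖ ^ 2` into one third and two thirds; the shares recombine because `d` does not depend on
  -- `V`.
  have key := ofReal_integral_add_le_condMutualInfo μ hU hV hT
    (a := fun q => -2 * ⟪d (q.1, q.2.1), (q.2.2 : E)⟫ - 1 / 3 * ‖d (q.1, q.2.1)‖ ^ 2)
    (b := fun q => 2 * ⟪d (q.1, q.2.1), (q.2.2 : E)⟫ - 2 / 3 * ‖d (q.1, q.2.1)‖ ^ 2)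
    ((hψ.const_mul _).sub (hd2.const_mul _)) ((hψ.const_mul _).sub (hd2.const_mul _)) (C := 8 * B)
    (fun p => by
      have h1 := abs_le.1 (hinnerb (p.1, p.2.1) _ (hnorm _ p.2.2.2))
      have h2 := hdb (p.1, p.2.1)
      have h3 := sq_nonneg ‖d (p.1, p.2.1)‖
      rw [abs_le]; constructor <;> linarith)
    (fun p => by
      have h1 := abs_le.1 (hinnerb (p.1, p.2.1) _ (hnorm _ p.2.2.2))
      have h2 := hdb (p.1, p.2.1)
      have h3 := sq_nonneg ‖d (p.1, p.2.1)‖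
      rw [abs_le]; constructor <;> linarith) (2 * B)
    (fun p r hr => by
      have h1 := abs_mul_le_klFun (r := r) hr hB0 (hinner (p.1, p.2.1) _ (hnorm _ p.2.2.2))
        (sq_nonneg _)
      have h2 := neg_abs_le (⟪d (p.1, p.2.1), (p.2.2 : E)⟫ * (r - 1))
      push_cast
      linarith)
  push_cast at key
  refine ⟨⟨_, hA⟩, le_trans (ENNReal.ofReal_le_ofReal ?_) key⟩
  rw [← integral_jointLaw_predict P π hℓm hℓC, ← integral_jointLaw_oracle (n := n) P π hℓC
    (g := fun p => F (l p.1) p.2)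
    (hℓm.comp (((measurable_labelled_predictor hF hl).comp (f := fun ω : W × (X × Y) =>
      (ω.1, ω.2.1)) (by fun_prop)).prodMk (by fun_prop)))]
  -- Under the product law `V` is independent of `U` given `T`, so it may be averaged first inside
  -- the inner product.
  have hprod : ∀ t, ∫ p, (2 * ⟪d (t, p.1), (p.2 : E)⟫ - 2 / 3 * ‖d (t, p.1)‖ ^ 2)
      ∂(condProd U V T μ t) =
      ∫ p, (2 * ⟪d (t, p.1), m t⟫ - 2 / 3 * ‖d (t, p.1)‖ ^ 2) ∂(condProd U V T μ t) := by
    intro t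
    simp only [Kernel.prod_apply]
    have hbd : ∀ u (v : E), ‖v‖ ≤ b →
        |2 * ⟪d (t, u), v⟫ - 2 / 3 * ‖d (t, u)‖ ^ 2| ≤ 8 * (B : ℝ) := fun u v hv => by
      have h1 := abs_le.1 (hinnerb (t, u) v hv)
      have h2 := hdb (t, u)
      have h3 := sq_nonneg ‖d (t, u)‖
      rw [abs_le]; constructor <;> linarith
    have hdt : Measurable fun p : W × Y => d (t, p.1) := hdm.comp (by fun_prop)
    have hi1 : Integrable (fun p : W × Y => 2 * ⟪d (t, p.1), (p.2 : E)⟫ - 2 / 3 * ‖d (t, p.1)‖ ^ 2)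
        ((condDistrib U T μ t).prod (condDistrib V T μ t)) :=
      .of_bound (((hdt.inner (by fun_prop)).const_mul _).sub
        ((hdt.norm.pow_const 2).const_mul _)).aestronglyMeasurable (8 * B)
        (ae_of_all _ fun p => hbd p.1 _ (hnorm _ p.2.2))
    have hi2 : Integrable (fun p : W × Y => 2 * ⟪d (t, p.1), m t⟫ - 2 / 3 * ‖d (t, p.1)‖ ^ 2)
        ((condDistrib U T μ t).prod (condDistrib V T μ t)) :=
      .of_bound (((hdt.inner measurable_const).const_mul _).sub
        ((hdt.norm.pow_const 2).const_mul _)).aestronglyMeasurable (8 * B)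
        (ae_of_all _ fun p => hbd p.1 _ (hmb t))
    rw [integral_prod _ hi1, integral_prod _ hi2]
    refine integral_congr_ae (ae_of_all _ fun u => ?_)
    have hi : Integrable (fun v : Y => ⟪d (t, u), (v : E)⟫) (condDistrib V T μ t) :=
      (hint t).const_inner _
    simp only
    rw [integral_sub (hi.const_mul _) (integrable_const _), integral_const_mul,
      integral_inner (hint t)]
    simp [m]
  have hprod' : ∫ t, ∫ p, (2 * ⟪d (t, p.1), (p.2 : E)⟫ - 2 / 3 * ‖d (t, p.1)‖ ^ 2)
      ∂(condProd U V T μ t) ∂(μ.map T) =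
      ∫ ω, (2 * ⟪d (T ω, U ω), m (T ω)⟫ - 2 / 3 * ‖d (T ω, U ω)‖ ^ 2) ∂μ := by
    simp_rw [hprod]
    refine integral_condProd_fst μ hU hT (f := fun q => 2 * ⟪d q, m q.1⟫ - 2 / 3 * ‖d q‖ ^ 2)
      (((hdm.inner (hmm.comp measurable_fst)).const_mul _).sub ((hdm.norm.pow_const 2).const_mul _))
      (C := 8 * B) fun q => ?_
    have h1 := abs_le.1 (hinnerb q _ (hmb q.1))
    have h2 := hdb q
    have h3 := sq_nonneg ‖d q‖
    rw [abs_le]; constructor <;> linarith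
  rw [hprod']
  have hdω : Measurable fun ω => d (T ω, U ω) := hdm.comp (hT.prodMk hU)
  have hVm : Measurable fun ω => (V ω : E) := measurable_subtype_coe.comp hV
  have hmT : Measurable fun ω => m (T ω) := hmm.comp hT
  have hi1 : Integrable (fun ω => -2 * ⟪d (T ω, U ω), (V ω : E)⟫ - 1 / 3 * ‖d (T ω, U ω)‖ ^ 2) μ :=
    .of_bound (((hdω.inner hVm).const_mul _).sub
      ((hdω.norm.pow_const 2).const_mul _)).aestronglyMeasurable (8 * B) (ae_of_all _ fun ω => by
        have h1 := abs_le.1 (hinnerb (T ω, U ω) _ (hnorm _ (V ω).2))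
        have h2 := hdb (T ω, U ω)
        have h3 := sq_nonneg ‖d (T ω, U ω)‖
        rw [Real.norm_eq_abs, abs_le]; constructor <;> linarith)
  have hi2 : Integrable (fun ω => 2 * ⟪d (T ω, U ω), m (T ω)⟫ - 2 / 3 * ‖d (T ω, U ω)‖ ^ 2) μ :=
    .of_bound (((hdω.inner hmT).const_mul _).sub
      ((hdω.norm.pow_const 2).const_mul _)).aestronglyMeasurable (8 * B) (ae_of_all _ fun ω => by
        have h1 := abs_le.1 (hinnerb (T ω, U ω) _ (hmb (T ω)))
        have h2 := hdb (T ω, U ω)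
        have h3 := sq_nonneg ‖d (T ω, U ω)‖
        rw [Real.norm_eq_abs, abs_le]; constructor <;> linarith)
  have hFm : Measurable fun ω => F (l (U ω)) (T ω).1 :=
    (measurable_labelled_predictor hF hl).comp (hU.prodMk (measurable_fst.comp hT))
  have hi3 : Integrable (fun ω => ℓ (F (l (U ω)) (T ω).1) (V ω)) μ :=
    .of_bound (hℓm.comp (hFm.prodMk hV)).aestronglyMeasurable (4 * B) (ae_of_all _ fun _ => hℓC _ _)
  have hi4 : Integrable (fun ω => ℓ (⟨(1 - ε) • m (T ω) + ε • y₀, hAmem _⟩ : Y) (V ω)) μ :=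
    .of_bound (hℓm.comp (((hmT.const_smul _).add_const _).subtype_mk.prodMk
      hV)).aestronglyMeasurable (4 * B) (ae_of_all _ fun _ => hℓC _ _)
  change ∫ ω, ℓ (⟨(1 - ε) • m (T ω) + ε • y₀, hAmem _⟩ : Y) (V ω) ∂μ -
    ∫ ω, ℓ (F (l (U ω)) (T ω).1) (V ω) ∂μ - 4 * B * ε ≤
    ∫ ω, (-2 * ⟪d (T ω, U ω), (V ω : E)⟫ - 1 / 3 * ‖d (T ω, U ω)‖ ^ 2) ∂μ + _
  rw [← integral_add hi1 hi2, ← integral_sub hi4 hi3]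
  have hconst : 4 * B * ε = ∫ _, 4 * B * ε ∂μ := by simp
  rw [hconst, ← integral_sub (by exact hi4.sub hi3) (integrable_const _)]
  refine integral_mono ((hi4.sub hi3).sub (integrable_const _)) (hi1.add hi2) fun ω => ?_
  simp only [hℓ]
  set M := m (T ω) with hM
  set v : E := ((V ω : Y) : E) with hv
  have hdω' : d (T ω, U ω) = M - F (l (U ω)) (T ω).1 := rfl
  have hconv : ‖(1 - ε) • M + ε • y₀ - v‖ ^ 2 ≤ ‖M - v‖ ^ 2 + 4 * B * ε := by
    have h1 : (1 - ε) • M + ε • y₀ - v = (1 - ε) • (M - v) + ε • (y₀ - v) := by module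
    have h2 : ‖(1 - ε) • M + ε • y₀ - v‖ ≤ (1 - ε) * ‖M - v‖ + ε * ‖y₀ - v‖ := by
      rw [h1]
      refine (norm_add_le _ _).trans ?_
      rw [norm_smul, norm_smul, Real.norm_of_nonneg hε.le, Real.norm_of_nonneg (by linarith)]
    have h3 := hsq y₀ v (hnorm _ (interior_subset hy₀)) (hnorm _ (V ω).2)
    have h4 : ‖(1 - ε) • M + ε • y₀ - v‖ ^ 2 ≤ ((1 - ε) * ‖M - v‖ + ε * ‖y₀ - v‖) ^ 2 := by gcongr
    nlinarith [mul_nonneg (mul_nonneg hε.le (sub_nonneg.2 hε1)) (sq_nonneg (‖M - v‖ - ‖y₀ - v‖)),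
      mul_nonneg hε.le (sq_nonneg ‖M - v‖), mul_le_mul_of_nonneg_left h3 hε.le]
  have hexp : ‖(F (l (U ω)) (T ω).1 : E) - v‖ ^ 2 =
      ‖M - v‖ ^ 2 - 2 * ⟪d (T ω, U ω), M - v⟫ + ‖d (T ω, U ω)‖ ^ 2 := by
    have : (F (l (U ω)) (T ω).1 : E) - v = (M - v) - d (T ω, U ω) := by rw [hdω']; abel
    rw [this, norm_sub_sq_real, real_inner_comm]
  have hin : ⟪d (T ω, U ω), M - v⟫ = ⟪d (T ω, U ω), M⟫ - ⟪d (T ω, U ω), v⟫ := inner_sub_right _ _ _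
  linarith

end Quadratic

/-! ### Total variation continuity and equicontinuity of the excess risk. -/

section TotalVariation

/-- The one-sided total variation bound `∫ g dμ ≤ ∫ g dν + δ` for measurable `0 ≤ g ≤ 1`. -/
def TVBound {α : Type*} [MeasurableSpace α] (δ : ℝ≥0∞) (μ ν : Measure α) : Prop :=
  ∀ g : α → ℝ≥0∞, Measurable g → (∀ a, g a ≤ 1) → ∫⁻ a, g a ∂μ ≤ ∫⁻ a, g a ∂ν + δ

namespace TVBound

variable {α β : Type*} [MeasurableSpace α] [MeasurableSpace β] {δ δ' : ℝ≥0∞} {μ ν : Measure α}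

/-- Test with `1 - g`; equal total masses turn the one-sided bound around. -/
theorem symm [IsProbabilityMeasure μ] [IsProbabilityMeasure ν] (h : TVBound δ μ ν) :
    TVBound δ ν μ := by
  intro g hg hg1
  have hfin : ∀ (ρ : Measure α) [IsProbabilityMeasure ρ], ∫⁻ a, g a ∂ρ ≠ ∞ := fun ρ _ =>
    ((lintegral_mono hg1).trans_lt (by simp)).ne
  have hcompl : ∀ (ρ : Measure α) [IsProbabilityMeasure ρ],
      ∫⁻ a, (1 - g a) ∂ρ + ∫⁻ a, g a ∂ρ = 1 := fun ρ _ => by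
    rw [← lintegral_add_right _ hg]
    simp [tsub_add_cancel_of_le (hg1 _)]
  have h1 := h (fun a => 1 - g a) (measurable_const.sub hg) fun a => tsub_le_self
  have h2 : 1 + ∫⁻ a, g a ∂ν ≤ 1 + (∫⁻ a, g a ∂μ + δ) := by
    calc 1 + ∫⁻ a, g a ∂ν = ∫⁻ a, (1 - g a) ∂μ + ∫⁻ a, g a ∂μ + ∫⁻ a, g a ∂ν := by rw [hcompl μ]
      _ ≤ (∫⁻ a, (1 - g a) ∂ν + δ) + ∫⁻ a, g a ∂μ + ∫⁻ a, g a ∂ν := by gcongr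
      _ = (∫⁻ a, (1 - g a) ∂ν + ∫⁻ a, g a ∂ν) + (∫⁻ a, g a ∂μ + δ) := by ring
      _ = _ := by rw [hcompl ν]
  exact (ENNReal.add_le_add_iff_left ENNReal.one_ne_top).1 h2

theorem prod [IsProbabilityMeasure μ] {μ' ν' : Measure β} [IsProbabilityMeasure μ']
    [IsProbabilityMeasure ν] [IsProbabilityMeasure ν']
    (h : TVBound δ μ ν) (h' : TVBound δ' μ' ν') : TVBound (δ + δ') (μ.prod μ') (ν.prod ν') := by
  intro g hg hg1
  rw [lintegral_prod _ hg.aemeasurable, lintegral_prod _ hg.aemeasurable]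
  calc ∫⁻ a, ∫⁻ b, g (a, b) ∂μ' ∂μ ≤ ∫⁻ a, (∫⁻ b, g (a, b) ∂ν' + δ') ∂μ :=
        lintegral_mono fun a => h' _ (by fun_prop) fun b => hg1 _
    _ = ∫⁻ a, ∫⁻ b, g (a, b) ∂ν' ∂μ + δ' := by
        rw [lintegral_add_right _ measurable_const]; simp
    _ ≤ (∫⁻ a, ∫⁻ b, g (a, b) ∂ν' ∂ν + δ) + δ' := by
        gcongr
        refine h _ hg.lintegral_prod_right' fun a => (lintegral_mono fun b => hg1 _).trans (by simp)
    _ = _ := by ring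

theorem map (h : TVBound δ μ ν) {f : α → β} (hf : Measurable f) :
    TVBound δ (μ.map f) (ν.map f) := by
  intro g hg hg1
  rw [lintegral_map hg hf, lintegral_map hg hf]
  exact h _ (hg.comp hf) fun a => hg1 _

theorem pi [IsProbabilityMeasure μ] [IsProbabilityMeasure ν] (h : TVBound δ μ ν) (n : ℕ) :
    TVBound (n * δ) (Measure.pi fun _ : Fin n => μ) (Measure.pi fun _ : Fin n => ν) := by
  induction n with
  | zero =>
    intro g _ _
    rw [Measure.pi_of_empty, Measure.pi_of_empty]
    exact self_le_add_right _ _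
  | succ n ih =>
    rw [pi_succ_eq_map, pi_succ_eq_map]
    have := (ih.prod h).map (measurable_finCons n)
    convert this using 1
    push_cast
    ring

theorem integral_le [IsProbabilityMeasure μ] [IsProbabilityMeasure ν] {δ : ℝ≥0}
    (h : TVBound δ μ ν) {g : α → ℝ} (hg : Measurable g) {C : ℝ≥0}
    (hC : ∀ a, 0 ≤ g a ∧ g a ≤ C) : ∫ a, g a ∂μ ≤ ∫ a, g a ∂ν + C * δ := by
  rcases eq_or_ne C 0 with rfl | hC0
  · have : g = 0 := funext fun a => le_antisymm (by simpa using (hC a).2) (hC a).1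
    simp [this]
  have hpos : (0 : ℝ) < C := by positivity
  have h1 := h (fun a => ENNReal.ofReal (g a / C)) (hg.div_const _).ennreal_ofReal fun a => by
    rw [ENNReal.ofReal_le_one, div_le_one hpos]; exact (hC a).2
  have hi : ∀ (ρ : Measure α) [IsProbabilityMeasure ρ], Integrable (fun a => g a / C) ρ :=
    fun ρ _ => (Integrable.of_bound hg.aestronglyMeasurable (C : ℝ) (ae_of_all _ fun a => by
      rw [Real.norm_of_nonneg (hC a).1]; exact (hC a).2)).div_const _
  have h0 : ∀ a, 0 ≤ g a / C := fun a => div_nonneg (hC a).1 hpos.le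
  rw [← ofReal_integral_eq_lintegral_ofReal (hi μ) (ae_of_all _ h0),
    ← ofReal_integral_eq_lintegral_ofReal (hi ν) (ae_of_all _ h0), ← ENNReal.ofReal_coe_nnreal,
    ← ENNReal.ofReal_add (integral_nonneg h0) δ.coe_nonneg, ENNReal.ofReal_le_ofReal_iff
      (add_nonneg (integral_nonneg h0) δ.coe_nonneg), integral_div, integral_div,
    div_add' _ _ _ hpos.ne', div_le_div_iff_of_pos_right hpos] at h1
  linarith

end TVBound

theorem tvBound_withDensity {α : Type*} [MeasurableSpace α] (ν : Measure α) {f g : α → ℝ≥0∞}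
    (hf : Measurable f) (hg : Measurable g) :
    TVBound (∫⁻ a, (f a - g a) ∂ν) (ν.withDensity f) (ν.withDensity g) := by
  intro h hh hh1
  rw [lintegral_withDensity_eq_lintegral_mul _ hf hh, lintegral_withDensity_eq_lintegral_mul _ hg hh,
    ← lintegral_add_left (hg.mul hh)]
  refine lintegral_mono fun a => ?_
  calc f a * h a ≤ (g a + (f a - g a)) * h a := by gcongr; exact le_add_tsub
    _ = g a * h a + (f a - g a) * h a := add_mul _ _ _
    _ ≤ g a * h a + (f a - g a) := by
        gcongr
        exact mul_le_of_le_one_right' (hh1 a)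

/-- Scheffé's lemma: pointwise continuity of the density gives continuity in total variation. -/
theorem eventually_tvBound {W Z : Type*} [TopologicalSpace W] [FirstCountableTopology W]
    [MeasurableSpace Z] (ν : Measure Z) {f : W → Z → ℝ} (hf0 : ∀ w z, 0 ≤ f w z)
    (hfm : ∀ w, Measurable (f w)) (hfc : ∀ z, Continuous fun w => f w z) {P : W → Measure Z}
    [∀ w, IsProbabilityMeasure (P w)]
    (hP : ∀ w, P w = ν.withDensity fun z => ENNReal.ofReal (f w z)) (w : W) {δ : ℝ≥0} (hδ : 0 < δ) :
    ∀ᶠ w' in nhds w, TVBound δ (P w) (P w') := by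
  have hlim : Filter.Tendsto (fun w' => ∫⁻ z, (ENNReal.ofReal (f w z) - ENNReal.ofReal (f w' z)) ∂ν)
      (nhds w) (nhds (∫⁻ _, 0 ∂ν)) := by
    -- The truncated difference is dominated by the density at the fixed `w`, of mass one, so no
    -- bound uniform in the parameter is required.
    refine tendsto_lintegral_filter_of_dominated_convergence (fun z => ENNReal.ofReal (f w z))
      (Filter.Eventually.of_forall fun w' => (hfm w).ennreal_ofReal.sub (hfm w').ennreal_ofReal)
      (Filter.Eventually.of_forall fun w' => ae_of_all _ fun z => tsub_le_self) ?_
      (ae_of_all _ fun z => ?_)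
    · have := measure_univ (μ := P w)
      rw [hP, withDensity_apply _ MeasurableSet.univ, Measure.restrict_univ] at this
      rw [this]
      exact ENNReal.one_ne_top
    · simp_rw [← ENNReal.ofReal_sub _ (hf0 _ z)]
      have : Continuous fun w' => ENNReal.ofReal (f w z - f w' z) :=
        ENNReal.continuous_ofReal.comp (continuous_const.sub (hfc z))
      simpa using this.tendsto w
  rw [lintegral_zero] at hlim
  filter_upwards [hlim.eventually_le_const (by exact_mod_cast hδ : (0 : ℝ≥0∞) < δ)] with w' hw' g hg hg1
  have := tvBound_withDensity ν (hfm w).ennreal_ofReal (hfm w').ennreal_ofReal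
  rw [← hP, ← hP] at this
  exact (this g hg hg1).trans (by gcongr)

variable {W X Y : Type*} [MeasurableSpace W] [MeasurableSpace X] [MeasurableSpace Y]
  (P : Kernel W (X × Y)) {n : ℕ} {ℓ : Y → Y → ℝ} {C : ℝ≥0}

theorem bddBelow_range_loss (hC : ∀ y y', 0 ≤ ℓ y y' ∧ ℓ y y' ≤ C) (w : W) :
    BddBelow (Set.range fun f : {f : X → Y // Measurable f} => ∫ z, ℓ (f.1 z.1) z.2 ∂(P w)) :=
  ⟨0, by rintro _ ⟨f, rfl⟩; exact integral_nonneg fun z => (hC _ _).1⟩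

variable [IsMarkovKernel P]

theorem expectedLoss_le_of_tvBound (hℓ : Measurable (Function.uncurry ℓ))
    (hC : ∀ y y', 0 ≤ ℓ y y' ∧ ℓ y y' ≤ C) {w w' : W} {δ : ℝ≥0} (h : TVBound δ (P w) (P w'))
    (A : LearningAlgorithm n X Y) :
    expectedLoss P ℓ A w ≤ expectedLoss P ℓ A w' + C * ((n + 1) * δ) := by
  have h1 := (h.pi n).prod h
  have h2 : ((n : ℝ≥0∞) * δ + δ) = ((((n + 1) * δ : ℝ≥0)) : ℝ≥0∞) := by push_cast; ring
  rw [h2] at h1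
  have := h1.integral_le (g := fun ζ => ℓ (A.predict (ζ.1, ζ.2.1)) ζ.2.2)
    (hℓ.comp ((A.measurable_predict.comp (by fun_prop)).prodMk (by fun_prop)))
    (fun a => hC _ _)
  push_cast at this
  exact this

variable [Nonempty Y]

instance : Nonempty {f : X → Y // Measurable f} :=
  ⟨⟨fun _ => Classical.arbitrary Y, measurable_const⟩⟩

theorem optimalLoss_le_of_tvBound (hℓ : Measurable (Function.uncurry ℓ))
    (hC : ∀ y y', 0 ≤ ℓ y y' ∧ ℓ y y' ≤ C) {w w' : W} {δ : ℝ≥0} (h : TVBound δ (P w) (P w')) :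
    optimalLoss P ℓ w ≤ optimalLoss P ℓ w' + C * δ := by
  rw [← sub_le_iff_le_add]
  refine le_ciInf fun f => ?_
  rw [sub_le_iff_le_add]
  refine (ciInf_le (bddBelow_range_loss P hC w) f).trans (h.integral_le ?_ fun a => hC _ _)
  exact hℓ.comp ((f.2.comp measurable_fst).prodMk measurable_snd)

/-- The expected loss involves `n + 1` draws and the optimal loss one more, giving `n + 2`. The
bound is uniform in `A`, which is what compactness needs. -/
theorem abs_excessRisk_sub_le_of_tvBound (hℓ : Measurable (Function.uncurry ℓ))
    (hC : ∀ y y', 0 ≤ ℓ y y' ∧ ℓ y y' ≤ C) {w w' : W} {δ : ℝ≥0} (h : TVBound δ (P w) (P w'))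
    (A : LearningAlgorithm n X Y) :
    |excessRisk P ℓ A w' - excessRisk P ℓ A w| ≤ C * ((n + 2) * δ) := by
  have h1 := expectedLoss_le_of_tvBound P hℓ hC h A
  have h2 := expectedLoss_le_of_tvBound P hℓ hC h.symm A
  have h3 := optimalLoss_le_of_tvBound P hℓ hC h
  have h4 := optimalLoss_le_of_tvBound P hℓ hC h.symm
  unfold excessRisk
  rw [abs_le]
  constructor <;> linarith

end TotalVariation

/-! ### Minimax by separation and compactness. -/

section Minimax

/-- A finite minimax theorem: if against every mixture of the finitely many states some action has
value at most `v`, then some finite mixture of actions has value below `v + ε` in all states. -/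
theorem exists_mixture_lt {𝒜 S : Type*} [Fintype S] [Nonempty S] (e : 𝒜 → S → ℝ) {v : ℝ}
    (h : ∀ p : S → ℝ, (∀ s, 0 ≤ p s) → ∑ s, p s = 1 → ∃ a, ∑ s, p s * e a s ≤ v)
    {ε : ℝ} (hε : 0 < ε) :
    ∃ (κ : Type) (_ : Fintype κ) (q : κ → ℝ) (a : κ → 𝒜), (∀ k, 0 ≤ q k) ∧ ∑ k, q k = 1 ∧
      ∀ s, ∑ k, q k * e (a k) s < v + ε := by
  classical
  by_contra hcon
  push Not at hcon
  -- If no mixture works, the open orthant below `v + ε` misses the convex hull of the risk vectors,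
  -- and a separating functional becomes a prior that contradicts `h`.
  have hdisj : Disjoint (Set.univ.pi fun _ : S => Set.Iio (v + ε))
      (convexHull ℝ (Set.range e)) := by
    rw [Set.disjoint_left]
    intro g hg hg'
    obtain ⟨κ, _, q, z, hq, hq1, hz, rfl⟩ := mem_convexHull_iff_exists_fintype.1 hg'
    choose a ha using hz
    obtain ⟨s, hs⟩ := hcon κ inferInstance q a hq hq1
    have := hg s (Set.mem_univ s)
    simp only [Set.mem_Iio, Finset.sum_apply, Pi.smul_apply, smul_eq_mul, ← ha] at this
    linarith
  obtain ⟨φ, u, hφ, hφ'⟩ := geometric_hahn_banach_open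
    (convex_pi fun _ _ => convex_Iio (v + ε)) (isOpen_set_pi Set.finite_univ fun _ _ => isOpen_Iio)
    (convex_convexHull ℝ _) hdisj
  set c : S → ℝ := fun s => φ (Pi.single s 1) with hc
  have hφc : ∀ g : S → ℝ, φ g = ∑ s, c s * g s := fun g => by
    conv_lhs => rw [pi_eq_sum_univ' g]
    rw [map_sum]
    refine Finset.sum_congr rfl fun s _ => ?_
    rw [map_smul, smul_eq_mul, mul_comm]
  have hφv : φ (fun _ => v) < u := hφ _ fun s _ => by simpa using hε
  have hc0 : ∀ s, 0 ≤ c s := by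
    intro s
    by_contra hneg
    push Not at hneg
    -- With `c s < 0`, lowering coordinate `s` stays in the orthant and raises `φ`; this step length
    -- makes `φ` equal to `u`, where it should be below `u`.
    have h1 := hφ ((fun _ => v) - ((φ (fun _ => v) - u) / c s) • Pi.single s 1) fun j _ => by
      have : 0 ≤ (φ (fun _ => v) - u) / c s :=
        div_nonneg_of_nonpos (by linarith) hneg.le
      have h2 : 0 ≤ (Pi.single s (1 : ℝ) : S → ℝ) j := by
        rw [Pi.single_apply]; split_ifs <;> norm_num
      simp only [Pi.sub_apply, Pi.smul_apply, smul_eq_mul, Set.mem_Iio]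
      nlinarith [mul_nonneg this h2]
    rw [map_sub, map_smul, smul_eq_mul] at h1
    change _ - _ / c s * c s < u at h1
    rw [div_mul_cancel₀ _ hneg.ne] at h1
    linarith
  have hcs : 0 < ∑ s, c s := by
    refine lt_of_le_of_ne (Finset.sum_nonneg fun s _ => hc0 s) fun h0 => ?_
    have hz : ∀ s, c s = 0 := fun s =>
      (Finset.sum_eq_zero_iff_of_nonneg fun s _ => hc0 s).1 h0.symm s (Finset.mem_univ s)
    obtain ⟨a, -⟩ := h (Pi.single (Classical.arbitrary S) 1)
      (fun s => by rw [Pi.single_apply]; split_ifs <;> norm_num) (by simp)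
    have h1 := hφ' (e a) (subset_convexHull ℝ _ ⟨a, rfl⟩)
    simp only [hφc, hz, zero_mul, Finset.sum_const_zero] at h1 hφv
    linarith
  obtain ⟨a, ha⟩ := h (fun s => c s / ∑ s, c s) (fun s => div_nonneg (hc0 s) hcs.le)
    (by rw [← Finset.sum_div, div_self hcs.ne'])
  have h1 := hφ' (e a) (subset_convexHull ℝ _ ⟨a, rfl⟩)
  rw [hφc] at h1
  rw [hφc, ← Finset.sum_mul] at hφv
  have h2 : ∑ s, c s / (∑ s, c s) * e a s = (∑ s, c s * e a s) / ∑ s, c s := by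
    rw [Finset.sum_div]
    exact Finset.sum_congr rfl fun s _ => by ring
  rw [h2, div_le_iff₀ hcs] at ha
  linarith

/-- The probability measure `∑ k, q k • δ_{x k}` for nonnegative weights summing to one. -/
def mixture {κ α : Type*} [Fintype κ] [MeasurableSpace α] (q : κ → ℝ) (x : κ → α) : Measure α :=
  ∑ k, ENNReal.ofReal (q k) • Measure.dirac (x k)

section Mixture

variable {κ α : Type*} [Fintype κ] [MeasurableSpace α] {q : κ → ℝ}

theorem isProbabilityMeasure_mixture (hq : ∀ k, 0 ≤ q k) (hq1 : ∑ k, q k = 1) (x : κ → α) :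
    IsProbabilityMeasure (mixture q x) :=
  ⟨by simp [mixture, Measure.finsetSum_apply, ← ENNReal.ofReal_sum_of_nonneg fun k _ => hq k, hq1]⟩

theorem integral_mixture (hq : ∀ k, 0 ≤ q k) (x : κ → α) {g : α → ℝ} (hg : StronglyMeasurable g) :
    ∫ a, g a ∂(mixture q x) = ∑ k, q k * g (x k) := by
  unfold mixture
  rw [integral_finsetSum_measure]
  · refine Finset.sum_congr rfl fun k _ => ?_
    rw [integral_smul_measure, integral_dirac' _ _ hg, ENNReal.toReal_ofReal (hq k), smul_eq_mul]
  · exact fun k _ => (integrable_dirac' hg (by simp)).smul_measure ENNReal.ofReal_ne_top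

theorem ae_mixture (x : κ → α) {p : α → Prop} (hp : MeasurableSet {a | p a}) (hx : ∀ k, p (x k)) :
    ∀ᵐ a ∂(mixture q x), p a := by
  rw [ae_iff]
  simp only [mixture, Measure.finsetSum_apply, Measure.smul_apply]
  refine Finset.sum_eq_zero fun k _ => ?_
  have := ae_iff.1 ((ae_dirac_iff hp).2 (hx k))
  simp [this]

end Mixture

/-- For losses that are equicontinuous over a compact state space, it suffices to bound the Bayes
values of the finitely supported priors. -/
theorem exists_probabilityMeasure_integral_le {𝒜 W : Type*} [MeasurableSpace 𝒜] [MetricSpace W]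
    [CompactSpace W] [Nonempty W] [MeasurableSpace W] [BorelSpace W] (e : 𝒜 → W → ℝ)
    (hm : ∀ w, Measurable fun a => e a w)
    (he : ∀ w, ∀ ε > 0, ∀ᶠ w' in nhds w, ∀ a, |e a w' - e a w| ≤ ε) {v : ℝ}
    (h : ∀ (S : Finset W) (π : ProbabilityMeasure W), (∀ᵐ w ∂(π : Measure W), w ∈ S) →
      ∀ ε > 0, ∃ a, ∫ w, e a w ∂(π : Measure W) ≤ v + ε) {ε : ℝ} (hε : 0 < ε) :
    ∃ Q : ProbabilityMeasure 𝒜, ∀ π : ProbabilityMeasure W,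
      ∫ a, ∫ w, e a w ∂(π : Measure W) ∂(Q : Measure 𝒜) ≤ v + ε := by
  have hc : ∀ a, Continuous (e a) := fun a => by
    refine continuous_iff_continuousAt.2 fun w => Metric.tendsto_nhds.2 fun δ hδ => ?_
    filter_upwards [he w (δ / 2) (by positivity)] with w' hw'
    rw [Real.dist_eq]
    exact (hw' a).trans_lt (by linarith)
  have hint : ∀ a (π : ProbabilityMeasure W), Integrable (e a) (π : Measure W) := fun a π =>
    (hc a).integrable_of_hasCompactSupport (HasCompactSupport.of_compactSpace _)
  -- The error is spent in three parts: the net, the near-optimal Bayes action, and the strict slack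
  -- of the mixture.
  obtain ⟨S, hS⟩ := CompactSpace.elim_nhds_subcover
    (fun w => {w' | ∀ a, |e a w' - e a w| ≤ ε / 3}) fun w => he w (ε / 3) (by positivity)
  have hS' : ∀ w', ∃ w ∈ S, ∀ a, |e a w' - e a w| ≤ ε / 3 := fun w' => by
    have : w' ∈ ⋃ w ∈ S, {w' | ∀ a, |e a w' - e a w| ≤ ε / 3} := hS ▸ Set.mem_univ w'
    simpa using this
  have : Nonempty S := let ⟨w, hw, _⟩ := hS' (Classical.arbitrary W); ⟨⟨w, hw⟩⟩
  obtain ⟨κ, _, q, a, hq, hq1, hlt⟩ := exists_mixture_lt (fun a (s : S) => e a s) (v := v + ε / 3)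
    (fun p hp hp1 => by
      obtain ⟨a, ha⟩ := h S ⟨mixture p ((↑) : S → W), isProbabilityMeasure_mixture hp hp1 _⟩
        (ae_mixture _ S.measurableSet fun s => s.2) (ε / 3) (by positivity)
      refine ⟨a, ?_⟩
      rwa [ProbabilityMeasure.coe_mk, integral_mixture hp _ (hc a).stronglyMeasurable] at ha)
    (show 0 < ε / 3 by positivity)
  refine ⟨⟨mixture q a, isProbabilityMeasure_mixture hq hq1 a⟩, fun π => ?_⟩
  have hjoint : Measurable (Function.uncurry fun w a => e a w) :=
    measurable_uncurry_of_continuous_of_measurable hc hm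
  have hsm : StronglyMeasurable fun a => ∫ w, e a w ∂(π : Measure W) :=
    StronglyMeasurable.integral_prod_right (hjoint.comp measurable_swap).stronglyMeasurable
  rw [ProbabilityMeasure.coe_mk, integral_mixture hq a hsm]
  calc ∑ k, q k * ∫ w, e (a k) w ∂(π : Measure W)
      = ∫ w, ∑ k, q k * e (a k) w ∂(π : Measure W) := by
        rw [integral_finsetSum _ fun k _ => (hint (a k) π).const_mul (q k)]
        simp_rw [integral_const_mul]
    _ ≤ ∫ _, (v + ε) ∂(π : Measure W) := by
        refine integral_mono (integrable_finsetSum _ fun k _ => (hint (a k) π).const_mul (q k))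
          (integrable_const _) fun w => ?_
        obtain ⟨s, hs, hws⟩ := hS' w
        have h1 : ∑ k, q k * e (a k) w ≤ ∑ k, (q k * e (a k) s + q k * (ε / 3)) :=
          Finset.sum_le_sum fun k _ => by
            rw [← mul_add]
            exact mul_le_mul_of_nonneg_left (by linarith [(abs_le.1 (hws (a k))).2]) (hq k)
        rw [Finset.sum_add_distrib, ← Finset.sum_mul, hq1] at h1
        have := hlt ⟨s, hs⟩
        simp only at this ⊢
        linarith
    _ = v + ε := by simp

end Minimax

/-! ### Finitely supported priors and oracles. -/

section FinitelySupportedPrior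

/-- Spares any discussion of the measurability of `optimalLoss` or of the oracle risk in the
parameter. -/
theorem integrable_of_ae_mem_finset {W : Type*} [MeasurableSpace W] [MeasurableSingletonClass W]
    {π : Measure W} [IsFiniteMeasure π] {S : Finset W} (hS : ∀ᵐ w ∂π, w ∈ S) (g : W → ℝ) :
    Integrable g π := by
  rw [← Measure.restrict_eq_self_of_ae_mem (s := (S : Set W)) hS]
  exact IntegrableOn.finset

variable {W X Y : Type*} [MeasurableSpace W] [MeasurableSingletonClass W] [MeasurableSpace X]
  [MeasurableSpace Y] (P : Kernel W (X × Y)) {n : ℕ} {ℓ : Y → Y → ℝ}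
  {π : ProbabilityMeasure W} {S : Finset W}

theorem integral_excessRisk (hS : ∀ᵐ w ∂(π : Measure W), w ∈ S) (A : LearningAlgorithm n X Y) :
    ∫ w, excessRisk P ℓ A w ∂(π : Measure W) = ∫ w, expectedLoss P ℓ A w ∂(π : Measure W) -
      ∫ w, optimalLoss P ℓ w ∂(π : Measure W) :=
  integral_sub (integrable_of_ae_mem_finset hS _) (integrable_of_ae_mem_finset hS _)

/-- Under a finitely supported prior, an oracle that knows the parameter can be realised by
finitely many predictors. -/
theorem exists_labelled_oracle [Nonempty Y] (hS : ∀ᵐ w ∂(π : Measure W), w ∈ S) {ε : ℝ}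
    (hε : 0 < ε) :
    ∃ (_ : Nonempty S) (F : S → X → Y) (l : W → S), (∀ i, Measurable (F i)) ∧ Measurable l ∧
      ∫ w, ∫ z, ℓ (F (l w) z.1) z.2 ∂(P w) ∂(π : Measure W) ≤
        ∫ w, optimalLoss P ℓ w ∂(π : Measure W) + ε := by
  classical
  obtain ⟨w₀, hw₀⟩ := hS.exists
  -- The infimum need not be attained, hence the slack `ε`. Off `S`, a null set, the label defaults
  -- to `w₀`.
  have hF : ∀ w, ∃ f : {f : X → Y // Measurable f},
      ∫ z, ℓ (f.1 z.1) z.2 ∂(P w) < optimalLoss P ℓ w + ε := fun w =>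
    exists_lt_of_ciInf_lt (lt_add_of_pos_right _ hε)
  choose f hf using hF
  refine ⟨⟨w₀, hw₀⟩, fun s => (f s).1, fun w => if h : w ∈ S then ⟨w, h⟩ else ⟨w₀, hw₀⟩,
    fun s => (f s).2, ?_, ?_⟩
  · exact Measurable.dite (s := {w | w ∈ S}) measurable_id measurable_const S.measurableSet
  · calc _ ≤ ∫ w, (optimalLoss P ℓ w + ε) ∂(π : Measure W) := by
          refine integral_mono_ae (integrable_of_ae_mem_finset hS _)
            (integrable_of_ae_mem_finset hS _) ?_
          filter_upwards [hS] with w hw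
          simp only [hw, dite_true]
          exact (hf w).le
      _ = _ := by
          rw [integral_add (integrable_of_ae_mem_finset hS _) (integrable_const _)]
          simp

end FinitelySupportedPrior

/-! ### Bayes excess risk against the worst-case information. -/

section Bayes

variable {W X Y : Type*} [MeasurableSpace W] [StandardBorelSpace W] [Nonempty W]
  [MeasurableSpace X] [MeasurableSpace Y] [StandardBorelSpace Y] [Nonempty Y]
  (P : Kernel W (X × Y)) [IsMarkovKernel P] {n : ℕ} {ℓ : Y → Y → ℝ}
  {π : ProbabilityMeasure W} {S : Finset W} {B : ℝ≥0} {ε : ℝ}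

theorem predictiveInfo_le_worstPredictiveInfo (π : ProbabilityMeasure W) :
    predictiveInfo P n π ≤ worstPredictiveInfo P n :=
  le_iSup (fun π => predictiveInfo P n π) π

theorem exists_integral_excessRisk_le_of_realizable (hℓ : Measurable (Function.uncurry ℓ))
    (hB : ∀ y y', 0 ≤ ℓ y y' ∧ ℓ y y' ≤ B) (hL : ∀ w, optimalLoss P ℓ w = 0)
    (hV : 3 * B * worstPredictiveInfo P n ≠ ∞) (hS : ∀ᵐ w ∂(π : Measure W), w ∈ S) (hε : 0 < ε) :
    ∃ A : LearningAlgorithm n X Y, ∫ w, excessRisk P ℓ A w ∂(π : Measure W) ≤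
      (3 * B * worstPredictiveInfo P n).toReal + ε := by
  -- The oracle risk enters with a factor `3`, hence `ε / 3`.
  obtain ⟨_, F, l, hF, hl, hO⟩ := exists_labelled_oracle P (ℓ := ℓ) hS
    (show 0 < ε / 3 by positivity)
  obtain ⟨A, hA⟩ := exists_bayes_of_realizable P (n := n) π hF hl hℓ hB
  refine ⟨A, ?_⟩
  rw [integral_excessRisk P hS]
  have h1 := (ENNReal.ofReal_le_iff_le_toReal hV).1
    (hA.trans (mul_le_mul_right (predictiveInfo_le_worstPredictiveInfo P π) _))
  simp only [hL, integral_zero] at hO ⊢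
  linarith

theorem exists_integral_excessRisk_le_of_bounded (hℓ : Measurable (Function.uncurry ℓ))
    (hB : ∀ y y', 0 ≤ ℓ y y' ∧ ℓ y y' ≤ B)
    (hV : B * (worstPredictiveInfo P n / 2) ^ (1 / 2 : ℝ) ≠ ∞)
    (hS : ∀ᵐ w ∂(π : Measure W), w ∈ S) (hε : 0 < ε) :
    ∃ A : LearningAlgorithm n X Y, ∫ w, excessRisk P ℓ A w ∂(π : Measure W) ≤
      (B * (worstPredictiveInfo P n / 2) ^ (1 / 2 : ℝ)).toReal + ε := by
  obtain ⟨_, F, l, hF, hl, hO⟩ := exists_labelled_oracle P (ℓ := ℓ) hS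
    (show 0 < ε / 2 by positivity)
  rcases eq_or_ne B 0 with rfl | hB0
  · obtain ⟨A, hA⟩ := exists_bayes_of_bounded P (n := n) π hF hl hℓ hB one_pos
    refine ⟨A, ?_⟩
    rw [integral_excessRisk P hS]
    simp at hA ⊢
    linarith
  have hI : worstPredictiveInfo P n ≠ ∞ := by
    intro hI
    refine hV ?_
    rw [hI, ENNReal.top_div_of_ne_top ENNReal.ofNat_ne_top, ENNReal.top_rpow_of_pos (by norm_num),
      ENNReal.mul_top (by simpa using hB0)]
  set r : ℝ := (worstPredictiveInfo P n).toReal with hr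
  set s : ℝ≥0 := ((worstPredictiveInfo P n / 2) ^ (1 / 2 : ℝ)).toNNReal with hs
  have hBpos : (0 : ℝ) < B := by positivity
  -- The optimal `τ` is `s = √(I / 2)`, which may vanish. Adding `η` keeps it positive and costs `B
  -- * η / 2 = ε / 2`.
  set η : ℝ≥0 := ⟨ε / B, by positivity⟩ with hη
  have hηpos : (0 : ℝ) < η := show 0 < ε / B by positivity
  have hs2 : (s : ℝ) ^ 2 = r / 2 := by
    rw [hs, ENNReal.coe_toNNReal_eq_toReal, ← ENNReal.toReal_rpow, ENNReal.toReal_div, ← hr,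
      ENNReal.toReal_ofNat, ← Real.sqrt_eq_rpow, Real.sq_sqrt (by positivity)]
  obtain ⟨A, hA⟩ := exists_bayes_of_bounded P (n := n) π hF hl hℓ hB
    (τ := s + η) (by have : 0 < η := hηpos; positivity)
  refine ⟨A, ?_⟩
  rw [integral_excessRisk P hS]
  have h1 := (ENNReal.ofReal_le_iff_le_toReal (ENNReal.mul_ne_top ENNReal.coe_ne_top hI)).1
    (hA.trans (mul_le_mul_right (predictiveInfo_le_worstPredictiveInfo P π) _))
  rw [ENNReal.toReal_mul, ENNReal.coe_toReal, ← hr] at h1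
  push_cast at h1
  have h2 : (B : ℝ) / (4 * (s + η)) * r ≤ B * s / 2 := by
    rw [div_mul_eq_mul_div, div_le_iff₀ (by positivity)]
    have : (B : ℝ) * r = B * (2 * (s : ℝ) ^ 2) := by rw [hs2]; ring
    rw [this]
    have : 0 ≤ (B : ℝ) * s * η := by positivity
    nlinarith
  have h3 : (B : ℝ) * η = ε := by
    change (B : ℝ) * (ε / B) = ε
    field_simp
  have h4 : (B * (worstPredictiveInfo P n / 2) ^ (1 / 2 : ℝ)).toReal = (B : ℝ) * s := by
    rw [ENNReal.toReal_mul, ENNReal.coe_toReal, hs, ENNReal.coe_toNNReal_eq_toReal]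
  rw [h4]
  nlinarith

end Bayes

theorem exists_integral_excessRisk_le_of_quadratic {W X : Type*} [MeasurableSpace W]
    [StandardBorelSpace W] [Nonempty W] [MeasurableSpace X] {E : Type*} [NormedAddCommGroup E]
    [InnerProductSpace ℝ E] [CompleteSpace E] [MeasurableSpace E] [BorelSpace E]
    [SecondCountableTopology E] {Y : Set E} [StandardBorelSpace Y] [Nonempty Y]
    (hYc : Convex ℝ Y) (hY : (interior Y).Nonempty) {B : ℝ≥0} (hB : ∀ y ∈ Y, ‖y‖ ^ 2 ≤ B)
    (P : Kernel W (X × Y)) [IsMarkovKernel P] {n : ℕ} {ℓ : Y → Y → ℝ}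
    (hℓ : ∀ y y' : Y, ℓ y y' = ‖(y : E) - y'‖ ^ 2)
    {π : ProbabilityMeasure W} {S : Finset W} {ε : ℝ}
    (hV : 2 * B * worstPredictiveInfo P n ≠ ∞) (hS : ∀ᵐ w ∂(π : Measure W), w ∈ S) (hε : 0 < ε) :
    ∃ A : LearningAlgorithm n X Y, ∫ w, excessRisk P ℓ A w ∂(π : Measure W) ≤
      (2 * B * worstPredictiveInfo P n).toReal + ε := by
  obtain ⟨y₀, hy₀⟩ := hY
  obtain ⟨_, F, l, hF, hl, hO⟩ := exists_labelled_oracle P (ℓ := ℓ) hS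
    (show 0 < ε / 2 by positivity)
  -- Chosen so that the shift into the interior costs at most `ε / 2`; the `+ 1` covers `B = 0`.
  set δ : ℝ := min 1 (ε / (8 * B + 1)) with hδ
  have hδpos : 0 < δ := lt_min one_pos (by positivity)
  have hδ' : 4 * (B : ℝ) * δ ≤ ε / 2 := by
    have h1 : δ * (8 * B + 1) ≤ ε := (le_div_iff₀ (by positivity)).1 (min_le_right _ _)
    nlinarith
  obtain ⟨A, hA⟩ := exists_bayes_of_quadratic hYc hy₀ hB P (n := n) π hF hl hℓ hδpos
    (min_le_left _ _)
  refine ⟨A, ?_⟩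
  rw [integral_excessRisk P hS]
  have h1 := (ENNReal.ofReal_le_iff_le_toReal hV).1
    (hA.trans (mul_le_mul_right (predictiveInfo_le_worstPredictiveInfo P π) _))
  linarith

/-! ### From Bayes bounds to the minimax excess risk. -/

section MinimaxExcessRiskBound

/-- Reduces each of the three regimes to a Bayes bound for finitely supported priors; an infinite
`V` leaves nothing to prove. -/
theorem minimaxExcessRisk_le {W X Y : Type*} [MetricSpace W] [CompactSpace W] [Nonempty W]
    [MeasurableSpace W] [BorelSpace W] [MeasurableSpace X] [MeasurableSpace Y] [Nonempty Y] {n : ℕ}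
    [MeasurableSpace (LearningAlgorithm n X Y)] (P : Kernel W (X × Y)) [IsMarkovKernel P]
    (ν : Measure (X × Y)) {f : W → X × Y → ℝ} (hf₀ : ∀ w z, 0 ≤ f w z)
    (hfm : ∀ w, Measurable (f w)) (hfc : ∀ z, Continuous fun w => f w z)
    (hP : ∀ w, P w = ν.withDensity fun z => ENNReal.ofReal (f w z))
    {ℓ : Y → Y → ℝ} (hℓ : Measurable (Function.uncurry ℓ)) {C : ℝ≥0}
    (hC : ∀ y y', 0 ≤ ℓ y y' ∧ ℓ y y' ≤ C)
    (hm : ∀ w, Measurable fun A : LearningAlgorithm n X Y => excessRisk P ℓ A w) {V : ℝ≥0∞}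
    (h : V ≠ ∞ → ∀ (S : Finset W) (π : ProbabilityMeasure W), (∀ᵐ w ∂(π : Measure W), w ∈ S) →
      ∀ ε > 0, ∃ A : LearningAlgorithm n X Y,
        ∫ w, excessRisk P ℓ A w ∂(π : Measure W) ≤ V.toReal + ε) :
    minimaxExcessRisk n P ℓ ≤ (V : EReal) := by
  rcases eq_or_ne V ∞ with rfl | hV
  · simp
  have he : ∀ w, ∀ ε > 0, ∀ᶠ w' in nhds w, ∀ A : LearningAlgorithm n X Y,
      |excessRisk P ℓ A w' - excessRisk P ℓ A w| ≤ ε := by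
    intro w ε hε
    set δ : ℝ≥0 := ⟨ε / (C * (n + 2) + 1), by positivity⟩ with hδ
    have hδpos : 0 < δ := show 0 < ε / (C * (n + 2) + 1) by positivity
    filter_upwards [eventually_tvBound ν hf₀ hfm hfc hP w hδpos] with w' hw' A
    refine (abs_excessRisk_sub_le_of_tvBound P hℓ hC hw' A).trans ?_
    change (C : ℝ) * ((n + 2) * (ε / (C * (n + 2) + 1))) ≤ ε
    have : (C : ℝ) * ((n + 2) * (ε / (C * (n + 2) + 1))) =
        (C * (n + 2)) * ε / (C * (n + 2) + 1) := by ring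
    rw [this, div_le_iff₀ (by positivity)]
    linarith
  refine EReal.le_of_forall_lt_iff_le.1 fun z hz => ?_
  rw [← EReal.coe_ennreal_toReal hV, EReal.coe_lt_coe_iff] at hz
  obtain ⟨Q, hQ⟩ := exists_probabilityMeasure_integral_le
    (fun (A : LearningAlgorithm n X Y) w => excessRisk P ℓ A w) hm he (h hV) (sub_pos.2 hz)
  refine (iInf_le _ Q).trans (iSup_le fun π => ?_)
  rw [EReal.coe_le_coe_iff]
  simpa using hQ π

/-- A convex set on which some probability measure has a Lebesgue density has interior points. -/
theorem interior_nonempty_of_density {X E : Type*} [MeasurableSpace X] [NormedAddCommGroup E]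
    [NormedSpace ℝ E] [FiniteDimensional ℝ E] [MeasurableSpace E] [BorelSpace E] {Y : Set E}
    (hYm : MeasurableSet Y) (hYc : Convex ℝ Y) (ν : Measure X) (μ : Measure E) [μ.IsAddHaarMeasure]
    {ρ : Measure (X × Y)} [IsProbabilityMeasure ρ] {g : X × Y → ℝ≥0∞}
    (hρ : ρ = (ν.prod (μ.comap (Subtype.val : Y → E))).withDensity g) :
    (interior Y).Nonempty := by
  by_contra hne
  rw [Set.not_nonempty_iff_eq_empty] at hne
  have h0 : μ Y = 0 := by
    refine measure_mono_null ?_ (hYc.addHaar_frontier μ)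
    rw [frontier, hne, Set.sdiff_empty]
    exact subset_closure
  have h1 : μ.comap (Subtype.val : Y → E) = 0 := by
    rw [← Measure.measure_univ_eq_zero, comap_subtype_coe_apply hYm]
    simpa using h0
  rw [h1, Measure.prod_zero, withDensity_zero_left] at hρ
  exact IsProbabilityMeasure.ne_zero ρ hρ

end MinimaxExcessRiskBound

end MinimaxExcessRisk

end

theorem theorem6
    {d p n : ℕ} (hn : 1 ≤ n)
    -- input and output spaces
    {X : Set (EuclideanSpace ℝ (Fin d))} (hXm : MeasurableSet X) (hXb : Bornology.IsBounded X)
    {Y : Set (EuclideanSpace ℝ (Fin p))} (hYm : MeasurableSet Y) (hYb : Bornology.IsBounded Y)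
    [Nonempty Y]
    -- compact metric parameter space
    {W : Type*} [MetricSpace W] [CompactSpace W] [Nonempty W] [MeasurableSpace W] [BorelSpace W]
    -- data distributions with Lebesgue densities that are bounded and continuous in the parameter
    (P : Kernel W (X × Y)) [IsMarkovKernel P]
    (f : W → X × Y → ℝ) (hf_nonneg : ∀ w z, 0 ≤ f w z) (hf_meas : ∀ w, Measurable (f w))
    (hf_bdd : ∀ z, ∃ C, ∀ w, f w z ≤ C) (hf_cont : ∀ z, Continuous fun w => f w z)
    (hf_density : ∀ w, P w = (((volume : Measure (EuclideanSpace ℝ (Fin d))).comap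
        (Subtype.val : X → EuclideanSpace ℝ (Fin d))).prod
      ((volume : Measure (EuclideanSpace ℝ (Fin p))).comap
        (Subtype.val : Y → EuclideanSpace ℝ (Fin p)))).withDensity
          fun z => ENNReal.ofReal (f w z))
    -- measurable loss function
    (ℓ : Y → Y → ℝ) (hℓ : Measurable (Function.uncurry ℓ))
    -- metric on the space of algorithms, for which the excess risk is Borel measurable
    [PseudoMetricSpace (MinimaxExcessRisk.LearningAlgorithm n X Y)]
    [MeasurableSpace (MinimaxExcessRisk.LearningAlgorithm n X Y)]
    [BorelSpace (MinimaxExcessRisk.LearningAlgorithm n X Y)]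
    (h_meas : ∀ w, Measurable fun A : MinimaxExcessRisk.LearningAlgorithm n X Y =>
      MinimaxExcessRisk.excessRisk P ℓ A w)
    -- bound on the channel capacity, and the constant of the loss
    (κ : ℝ≥0∞) (hκ : MinimaxExcessRisk.capacity P n ≤ κ) (B : ℝ≥0) :
    haveI : StandardBorelSpace Y := hYm.standardBorel
    -- (a) bounded quadratic loss
    ((∀ y y' : Y, ℓ y y' = ‖(y : EuclideanSpace ℝ (Fin p)) - y'‖ ^ 2) → Convex ℝ Y →
      (∀ y ∈ Y, ‖y‖ ^ 2 ≤ (B : ℝ)) →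
        MinimaxExcessRisk.minimaxExcessRisk n P ℓ ≤
            ((2 * B * MinimaxExcessRisk.worstPredictiveInfo P n : ℝ≥0∞) : EReal) ∧
          2 * B * MinimaxExcessRisk.worstPredictiveInfo P n ≤ 2 * B * κ / n) ∧
    -- (b) realizable bounded loss
    ((∀ y y' : Y, 0 ≤ ℓ y y' ∧ ℓ y y' ≤ B) →
      (∀ w, MinimaxExcessRisk.optimalLoss P ℓ w = 0) →
        MinimaxExcessRisk.minimaxExcessRisk n P ℓ ≤
            ((3 * B * MinimaxExcessRisk.worstPredictiveInfo P n : ℝ≥0∞) : EReal) ∧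
          3 * B * MinimaxExcessRisk.worstPredictiveInfo P n ≤ 3 * B * κ / n) ∧
    -- (c) general bounded loss
    ((∀ y y' : Y, 0 ≤ ℓ y y' ∧ ℓ y y' ≤ B) →
        MinimaxExcessRisk.minimaxExcessRisk n P ℓ ≤
            ((B * (MinimaxExcessRisk.worstPredictiveInfo P n / 2) ^ (1 / 2 : ℝ) : ℝ≥0∞) : EReal) ∧
          B * (MinimaxExcessRisk.worstPredictiveInfo P n / 2) ^ (1 / 2 : ℝ) ≤
            B * (κ / (2 * n)) ^ (1 / 2 : ℝ)) := by
  have : StandardBorelSpace X := hXm.standardBorel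
  have : StandardBorelSpace Y := hYm.standardBorel
  have : Nonempty X := (P (Classical.arbitrary W)).nonempty_of_neZero.map Prod.fst
  have hI : MinimaxExcessRisk.worstPredictiveInfo P n ≤ κ / n :=
    (MinimaxExcessRisk.worstPredictiveInfo_le_capacity_div P hn).trans
      (ENNReal.div_le_div_right hκ _)
  refine ⟨fun hquad hYc hB => ⟨?_, ?_⟩, fun hB hL => ⟨?_, ?_⟩, fun hB => ⟨?_, ?_⟩⟩
  -- The Lebesgue density supplies the interior point towards which the posterior mean is shifted.
  · have hY : (interior Y).Nonempty := MinimaxExcessRisk.interior_nonempty_of_density hYm hYc _ _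
      (hf_density (Classical.arbitrary W))
    refine MinimaxExcessRisk.minimaxExcessRisk_le P _ hf_nonneg hf_meas hf_cont hf_density hℓ
      (C := 4 * B) (fun y y' => ?_) h_meas fun hV S π hS ε hε =>
        MinimaxExcessRisk.exists_integral_excessRisk_le_of_quadratic hYc hY hB P hquad hV hS hε
    rw [hquad]
    refine ⟨sq_nonneg _, ?_⟩
    -- `‖y - y'‖² ≤ 2 (‖y‖² + ‖y'‖²) ≤ 4 B`; this constant serves only for equicontinuity and does
    -- not enter the final bound.
    have h1 := norm_sub_le (y : EuclideanSpace ℝ (Fin p)) y'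
    have h2 := hB y y.2
    have h3 := hB y' y'.2
    push_cast
    nlinarith [norm_nonneg ((y : EuclideanSpace ℝ (Fin p)) - y'),
      sq_nonneg (‖(y : EuclideanSpace ℝ (Fin p))‖ - ‖(y' : EuclideanSpace ℝ (Fin p))‖)]
  · rw [mul_div_assoc]
    gcongr
  · exact MinimaxExcessRisk.minimaxExcessRisk_le P _ hf_nonneg hf_meas hf_cont hf_density hℓ hB
      h_meas fun hV S π hS ε hε =>
        MinimaxExcessRisk.exists_integral_excessRisk_le_of_realizable P hℓ hB hL hV hS hε
  · rw [mul_div_assoc]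
    gcongr
  · exact MinimaxExcessRisk.minimaxExcessRisk_le P _ hf_nonneg hf_meas hf_cont hf_density hℓ hB
      h_meas fun hV S π hS ε hε =>
        MinimaxExcessRisk.exists_integral_excessRisk_le_of_bounded P hℓ hB hV hS hε
  · have h2 : MinimaxExcessRisk.worstPredictiveInfo P n / 2 ≤ κ / (2 * n) := by
      calc _ ≤ κ / n / 2 := by gcongr
        _ = κ / (2 * n) := by
          simp only [div_eq_mul_inv]
          rw [ENNReal.mul_inv (by simp) (by simp)]
          ring
    gcongr
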